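/- Let $\phi_L(\mathbf{x})=\tfrac12\mathbf{x}+(-\tfrac12,\tfrac32)$, $\phi_R(\mathbf{x})=\tfrac12\mathbf{x}+(1,\tfrac32)$ and $\Phi(S)=\phi_L(S)\cup\phi_R(S)$ for $S\subseteq\mathbb{R}^2$. Let $\Omega_0=([0,1]\times[0,1])\cup([-\tfrac12,\tfrac32]\times[1,\tfrac32])$, let $\Omega_n=\bigcup_{j=0}^n\Phi^j(\Omega_0)$ be the prefractal billiard tables, and let $\Omega=\overline{\bigcup_{n\ge0}\Omega_n}$ be the $T$-fractal table. Points of $\mathscr{E}=\Omega\setminus\bigcup_n\Omega_n$ are called elusive points. A sequence $(a_k)_{k\ge1}$ in $\{L,R\}$ is an address of $e\in\mathscr{E}$ if $\phi_{a_1}\circ\cdots\circ\phi_{a_n}(\mathbf{z})\to e$ as $n\to\infty$ for every $\mathbf{z}\in\mathbb{R}^2$; the elusive point $e$ is rational if it has a preperiodic address. The orbit of $\Omega_n$ with initial condition $(X,\theta)$, where $X\in\partial\Omega_n$ and $\theta$ is an inward pointing direction, is the sequence of point--direction pairs at $X$ and at the successive collisions with $\partial\Omega_n$ under the law of reflection (at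 a right-angle corner the motion turns back; at a reflex corner it terminates). The orbit is periodic if it returns to $(X,\theta)$. The initial conditions $(X_n,\theta)_{n\ge0}$ for the tables $\Omega_n$, with a common inward direction $\theta$ and with $X_n\in\partial\Omega_n\setminus\Phi^{n+1}([0,1]\times\{0\})$, are compatible if for all $m<n$ the points $X_m,X_n$ lie on a segment in the direction $\theta$ that meets $\partial\Omega_n$ only at $X_n$. The first escape time $\tau_n$ is the least $k\ge1$ for which the $k$-th collision point of the orbit of $\Omega_n$ lies in the set $\Phi^{n+1}([0,1]\times\{0\})$ of segments to be removed in the construction of $\Omega_{n+1}$ ($\tau_n=\infty$ if there is none). Let $\mathscr{N}_n(\theta)$ be the polygonal path of the orbit of $\Omega_n$ with initial condition $(X_n,\theta)$ from $X_n$ up to its $\tau_n$-th collision point $X_n^{\tau_n}$. If all $\tau_n$ are finite, then $\mathscr{N}(\theta)=\overline{\bigcup_n\mathscr{N}_n(\theta)}$ is called a nontrivial path, and it converges to $e\in\mathscr{E}$ if $X_n^{\tau_n}\to e$ and, for every neighbourhood $U$ of $e$, $\mathscr{N}(\theta)\setminus\mathscr{N}_n(\theta)\subseteq U$ for all sufficiently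 large $n$. **Theorem.** Let $p\ge1$ be an odd integer, let $x\in[0,1]$ satisfy $x\ne m2^{-l}$ for all positive integers $l,m$, and let $\theta^0\in(0,\pi)$ satisfy $\tan\theta^0=1/p$. Suppose that $(X_n,\theta^0)_{n\ge0}$ with $X_0=(x,0)$ are compatible initial conditions and that for every $n$ the orbit of $\Omega_n$ with initial condition $(X_n,\theta^0)$ is periodic. Then the initial conditions $(X_n,\theta^0)_{n\ge0}$ and $(X_n,\pi-\theta^0)_{n\ge0}$ are compatible and yield nontrivial paths $\mathscr{N}(\theta^0)$ and $\mathscr{N}(\pi-\theta^0)$, which converge to two distinct elusive points. If $x$ is rational, both elusive points are rational; if $x$ is irrational, neither of them is rational. -/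

import Mathlib

open Set Filter Topology

namespace TFractal

/-! ### The table and its approximations -/

abbrev Plane : Type := ℝ × ℝ

/-- The letters of an address: left copy, right copy. -/
inductive Side : Type
  | L
  | R

/-- The two contractions `x / 2 + (-1/2, 3/2)` (left) and `x / 2 + (1, 3/2)` (right). -/
noncomputable def phi : Side → Plane → Plane
  | Side.L => fun z => (z.1 / 2 - 1 / 2, z.2 / 2 + 3 / 2)
  | Side.R => fun z => (z.1 / 2 + 1, z.2 / 2 + 3 / 2)

/-- The action of the iterated function system on subsets of the plane. -/
def Phi (S : Set Plane) : Set Plane := phi Side.L '' S ∪ phi Side.R '' S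

/-- The unit square together with the `2 × 1/2` rectangle resting on top of it. -/
def baseTable : Set Plane :=
  Icc (0 : ℝ) 1 ×ˢ Icc (0 : ℝ) 1 ∪ Icc (-(1 / 2) : ℝ) (3 / 2) ×ˢ Icc (1 : ℝ) (3 / 2)

/-- The base of the table, the unit interval. -/
def baseSegment : Set Plane := Icc (0 : ℝ) 1 ×ˢ {(0 : ℝ)}

/-- The `n`-th prefractal table. -/
def preTable (n : ℕ) : Set Plane := ⋃ j ∈ Finset.range (n + 1), Phi^[j] baseTable

/-- The T-fractal table. -/
def table : Set Plane := closure (⋃ n, preTable n)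

/-- The points of the T-fractal table that lie in no prefractal table. -/
def elusivePoints : Set Plane := table \ ⋃ n, preTable n

/-- The union of the segments of the boundary of the `n`-th prefractal table that are removed in
the construction of the next one: the bases of the newly attached copies. -/
def removedSegments (n : ℕ) : Set Plane := Phi^[n + 1] baseSegment

/-! ### Addresses of elusive points -/

/-- `phi (a 0) ∘ phi (a 1) ∘ ⋯ ∘ phi (a (n - 1))`. -/
noncomputable def phiWord (a : ℕ → Side) : ℕ → Plane → Plane
  | 0 => id
  | n + 1 => phiWord a n ∘ phi (a n)

/-- `a` is an address of `e`: the successive copies chosen by the letters of `a` shrink to `e`. -/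
def HasAddress (e : Plane) (a : ℕ → Side) : Prop :=
  ∀ z : Plane, Tendsto (fun n => phiWord a n z) atTop (𝓝 e)

def IsPreperiodic (a : ℕ → Side) : Prop :=
  ∃ N q : ℕ, 0 < q ∧ ∀ n, N ≤ n → a (n + q) = a n

def IsRationalElusivePoint (e : Plane) : Prop :=
  e ∈ elusivePoints ∧ ∃ a : ℕ → Side, HasAddress e a ∧ IsPreperiodic a

/-! ### Billiards in a table all of whose sides are horizontal or vertical -/

/-- A basepoint together with a direction of motion (a vector). -/
abbrev State : Type := Plane × Plane

/-- `v` points from `q` into the table. -/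
def IsInward (Ω : Set Plane) (q v : Plane) : Prop :=
  ∃ ε : ℝ, 0 < ε ∧ ∀ t : ℝ, 0 < t → t < ε → q + t • v ∈ interior Ω

def OnHorizontalSide (Ω : Set Plane) (q : Plane) : Prop :=
  ∃ a b : ℝ, a < b ∧ q.1 ∈ Icc a b ∧ ∀ t ∈ Icc a b, (t, q.2) ∈ frontier Ω

def OnVerticalSide (Ω : Set Plane) (q : Plane) : Prop :=
  ∃ a b : ℝ, a < b ∧ q.2 ∈ Icc a b ∧ ∀ t ∈ Icc a b, (q.1, t) ∈ frontier Ω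

/-- The orbit of `v` under the group generated by the reflections in the sides through `q`. -/
def reflections (Ω : Set Plane) (q v : Plane) : Set Plane :=
  {w | (w.1 = v.1 ∨ (OnVerticalSide Ω q ∧ w.1 = -v.1)) ∧
       (w.2 = v.2 ∨ (OnHorizontalSide Ω q ∧ w.2 = -v.2))}

/-- One collision: the pointmass moves from `s.1` in the direction `s.2` through the interior of
the table until it meets the boundary at `r.1`, where it is reflected into the direction `r.2`.
The motion is continued only if exactly one of the directions obtained by reflecting `s.2` in the
sides through `r.1` points into the table. This is the law of reflection at a point that is not a
vertex; at a right angle the pointmass turns back, and at a reflex angle the motion ends. -/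
def Step (Ω : Set Plane) (s r : State) : Prop :=
  (∃ t : ℝ, 0 < t ∧ r.1 = s.1 + t • s.2 ∧ r.1 ∈ frontier Ω ∧
    ∀ u : ℝ, 0 < u → u < t → s.1 + u • s.2 ∈ interior Ω) ∧
  r.2 ∈ reflections Ω r.1 s.2 ∧ IsInward Ω r.1 r.2 ∧
  ∀ w ∈ reflections Ω r.1 s.2, IsInward Ω r.1 w → w = r.2

theorem Step.unique {Ω : Set Plane} {s r r' : State} (h : Step Ω s r) (h' : Step Ω s r') :
    r = r' := by
  obtain ⟨⟨t, ht, hq, hf, hi⟩, hr, hin, hu⟩ := h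
  obtain ⟨⟨t', ht', hq', hf', hi'⟩, hr', hin', hu'⟩ := h'
  have htt : t = t' := by
    rcases lt_trichotomy t t' with hlt | heq | hlt
    · have h1 := hi' t ht hlt
      rw [← hq] at h1
      exact absurd h1 hf.2
    · exact heq
    · have h1 := hi t' ht' hlt
      rw [← hq'] at h1
      exact absurd h1 hf'.2
  have h1 : r.1 = r'.1 := by rw [hq, hq', htt]
  rw [h1] at hr hin
  exact Prod.ext h1 (hu' _ hr hin)

open Classical in
/-- The (partially defined) billiard map. -/
noncomputable def billiardMap (Ω : Set Plane) (s : State) : Option State :=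
  if h : ∃ r, Step Ω s r then some h.choose else none

theorem billiardMap_eq_some {Ω : Set Plane} {s r : State} :
    billiardMap Ω s = some r ↔ Step Ω s r := by
  unfold billiardMap
  split_ifs with h
  · rw [Option.some_inj]
    exact ⟨fun e => e ▸ h.choose_spec, fun hr => h.choose_spec.unique hr⟩
  · exact ⟨fun e => e.elim, fun hr => (h ⟨r, hr⟩).elim⟩

/-- The orbit of a state; it takes the value `none` from the moment at which it terminates. -/
noncomputable def orbit (Ω : Set Plane) (s : State) : ℕ → Option State
  | 0 => some s
  | k + 1 => (orbit Ω s k).bind (billiardMap Ω)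

def IsPeriodicOrbit (Ω : Set Plane) (s : State) : Prop :=
  ∃ k : ℕ, 0 < k ∧ orbit Ω s k = some s

/-! ### Sequences of compatible orbits and nontrivial paths

A sequence of initial conditions is given by the basepoints `X n` on the boundaries of the
prefractal tables and by a common angle `θ`. -/

noncomputable def direction (θ : ℝ) : Plane := (Real.cos θ, Real.sin θ)

/-- The orbit of the `n`-th prefractal table in the direction `θ`. -/
noncomputable def orbitAt (X : ℕ → Plane) (θ : ℝ) (n : ℕ) : ℕ → Option State :=
  orbit (preTable n) (X n, direction θ)

/-- Compatible initial conditions: all basepoints are boundary points with the same inward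
direction, and for `m < n` the points `X m`, `X n` lie on a segment in that direction that meets
the boundary of the `n`-th table only at `X n`. -/
def IsCompatibleSequence (X : ℕ → Plane) (θ : ℝ) : Prop :=
  (∀ n, X n ∈ frontier (preTable n) ∧ X n ∉ removedSegments n ∧
    IsInward (preTable n) (X n) (direction θ)) ∧
  ∀ m n, m < n → ∃ (c : Plane) (t : ℝ),
    X m ∈ segment ℝ c (c + t • direction θ) ∧ X n ∈ segment ℝ c (c + t • direction θ) ∧
    segment ℝ c (c + t • direction θ) ∩ frontier (preTable n) = {X n}

/-- The first escape time: the least positive `k` for which the `k`-th basepoint of the orbit of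
the `n`-th table lies on a segment to be removed, or `⊤` if there is none. -/
noncomputable def firstEscapeTime (X : ℕ → Plane) (θ : ℝ) (n : ℕ) : ℕ∞ :=
  ⨅ k ∈ {k : ℕ | 0 < k ∧ ∃ s, orbitAt X θ n k = some s ∧ s.1 ∈ removedSegments n}, (k : ℕ∞)

/-- The path of the orbit of the `n`-th table up to its first escape time. -/
noncomputable def pathToEscape (X : ℕ → Plane) (θ : ℝ) (n : ℕ) : Set Plane :=
  {z | ∃ k : ℕ, (k : ℕ∞) < firstEscapeTime X θ n ∧ ∃ s r : State,
    orbitAt X θ n k = some s ∧ orbitAt X θ n (k + 1) = some r ∧ z ∈ segment ℝ s.1 r.1}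

noncomputable def nontrivialPath (X : ℕ → Plane) (θ : ℝ) : Set Plane :=
  closure (⋃ n, pathToEscape X θ n)

/-- The initial conditions `(X n, θ)` are compatible and yield a nontrivial path (all first escape
times are finite), and this path converges to the elusive point `e`: the points of first escape
tend to `e`, and what is left of the path once its `n`-th stage has been removed shrinks to `e`. -/
structure NontrivialPathConvergesTo (X : ℕ → Plane) (θ : ℝ) (e : Plane) : Prop where
  compatible : IsCompatibleSequence X θ
  escapes : ∀ n, firstEscapeTime X θ n ≠ ⊤
  elusive : e ∈ elusivePoints
  endpoints : ∃ y : ℕ → State, (∀ n, orbitAt X θ n (firstEscapeTime X θ n).toNat = some (y n)) ∧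
    Tendsto (fun n => (y n).1) atTop (𝓝 e)
  remainder : ∀ U ∈ 𝓝 e, ∀ᶠ n in atTop, nontrivialPath X θ \ pathToEscape X θ n ⊆ U

end TFractal

/-! Let a trajectory of slope ±1/p start on the base at signed distance u from the midpoint,
measured in the direction of motion. Since p is odd, unfolding the unit square brings it to height 1
with the same u and the orientation reversed. Write p = 4j + e with e = ±1. Each crossing of the
upper rectangle, whose width is 2, shifts u by e/2 modulo 2. If u has the sign of e, the first
crossing ends on the base of a copy. Otherwise the trajectory strikes the middle of the top, then a
ledge, and reaches the base of a copy on the third crossing. In both cases the rescaled coordinate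
in the copy is 2u - sign(u)/2, which is the doubling map for u + 1/2 (`exists_approach_phi`).

For x neither dyadic nor an endpoint, u never meets 0 or ±1/2, so this can be iterated forever. The
corner x = 0 is excluded by periodicity, because its orbit runs into a reflex corner
(`not_isPeriodicOrbit_corner`). By self-similarity the successive crossings of the base table,
contracted and joined, form the orbit of every prefractal table up to its escape
(`RenormalizedOrbit.exists_approach`). All that follows stage n lies in one contracted box of ratio
2^-(n+1), so the path converges to the point addressed by the itinerary
(`RenormalizedOrbit.converges`).

The letters determine the orientations, these the signs of the coordinates, and these are the binary
digits of x. Hence the itinerary is preperiodic exactly when x is rational. A point with two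
addresses has only preperiodic ones, so one address decides (`HasAddress.isRational_iff`). Reversing
the initial direction negates all coordinates; the first letter changes and the second does not,
which separates the two limits. -/

namespace TFractal

/-! ### Collisions with the sides of a table -/

/-- Interior and frontier are local notions, and a continuous open map pulls back those of the
half-line. -/
theorem eventually_mem_interior_frontier {Ω : Set Plane} {q : Plane} {f : Plane → ℝ}
    (hf : Continuous f) (ho : IsOpenMap f) (h : ∀ᶠ z in 𝓝 q, (z ∈ Ω ↔ 0 ≤ f z)) :
    ∀ᶠ z in 𝓝 q, (z ∈ interior Ω ↔ 0 < f z) ∧ (z ∈ frontier Ω ↔ f z = 0) := by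
  have hint : interior (f ⁻¹' Ici 0) = f ⁻¹' Ioi 0 := by
    rw [← ho.preimage_interior_eq_interior_preimage hf, interior_Ici]
  have hfr : frontier (f ⁻¹' Ici 0) = f ⁻¹' {0} := by
    rw [← ho.preimage_frontier_eq_frontier_preimage hf, frontier_Ici]
  filter_upwards [eventually_eventually_nhds.2 h] with z hz
  have h1 : z ∈ interior Ω ↔ z ∈ interior (f ⁻¹' Ici 0) := by
    rw [mem_interior_iff_mem_nhds, mem_interior_iff_mem_nhds]
    exact Filter.eventually_congr hz
  have h2 : z ∈ closure Ω ↔ z ∈ closure (f ⁻¹' Ici 0) := by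
    rw [mem_closure_iff_frequently, mem_closure_iff_frequently]
    exact Filter.frequently_congr hz
  refine ⟨by rw [h1, hint]; rfl, ?_⟩
  rw [frontier, Set.mem_sdiff, h1, h2, ← Set.mem_sdiff, ← frontier, hfr]
  rfl

theorem isOpenMap_mul_sub {n : ℝ} (hn : n ≠ 0) (c : ℝ) : IsOpenMap fun t : ℝ => n * (t - c) :=
  (Homeomorph.mulLeft₀ n hn).isOpenMap.comp (Homeomorph.subRight c).isOpenMap

theorem isInward_iff {Ω : Set Plane} {q v : Plane} :
    IsInward Ω q v ↔ ∀ᶠ t in 𝓝[>] (0 : ℝ), q + t • v ∈ interior Ω := by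
  rw [eventually_nhdsWithin_iff, Metric.eventually_nhds_iff]
  constructor
  · rintro ⟨ε, hε, h⟩
    refine ⟨ε, hε, fun t ht ht0 => h t ht0 ?_⟩
    rw [Real.dist_0_eq_abs] at ht
    exact (le_abs_self t).trans_lt ht
  · rintro ⟨ε, hε, h⟩
    refine ⟨ε, hε, fun t ht0 ht => h ?_ ht0⟩
    rw [Real.dist_0_eq_abs, abs_of_pos ht0]
    exact ht

theorem tendsto_add_smul (q v : Plane) :
    Tendsto (fun t : ℝ => q + t • v) (𝓝[>] 0) (𝓝 q) := by
  have : Continuous fun t : ℝ => q + t • v := by fun_prop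
  have h := this.tendsto 0
  simp only [zero_smul, add_zero] at h
  exact h.mono_left nhdsWithin_le_nhds

/-- Near `q` the table is a half-plane bounded by a vertical or a horizontal line through `q`, the
direction `v` points out of it, and `w` is the reflection of `v` in that line. -/
def Bounce (Ω : Set Plane) (q v w : Plane) : Prop :=
  (∃ n : ℝ, n * v.1 < 0 ∧ (∀ᶠ z in 𝓝 q, (z ∈ Ω ↔ 0 ≤ n * (z.1 - q.1))) ∧ w = (-v.1, v.2)) ∨
  (∃ n : ℝ, n * v.2 < 0 ∧ (∀ᶠ z in 𝓝 q, (z ∈ Ω ↔ 0 ≤ n * (z.2 - q.2))) ∧ w = (v.1, -v.2))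

theorem Bounce.mem {Ω : Set Plane} {q v w : Plane} (h : Bounce Ω q v w) : q ∈ Ω := by
  rcases h with ⟨n, -, h, -⟩ | ⟨n, -, h, -⟩ <;> exact h.self_of_nhds.2 (by simp)

theorem Bounce.congr {Ω Ω' : Set Plane} {q v w : Plane} (h : Bounce Ω q v w)
    (hΩ : ∀ᶠ z in 𝓝 q, (z ∈ Ω' ↔ z ∈ Ω)) : Bounce Ω' q v w := by
  rcases h with ⟨n, hn, h, hw⟩ | ⟨n, hn, h, hw⟩
  · exact Or.inl ⟨n, hn, by filter_upwards [hΩ, h] with z h1 h2 using h1.trans h2, hw⟩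
  · exact Or.inr ⟨n, hn, by filter_upwards [hΩ, h] with z h1 h2 using h1.trans h2, hw⟩

/-- Serves to show that a point of a vertical wall is on no horizontal side, and conversely: such a
side would contain nearby points off the wall. -/
theorem exists_mem_Icc_ne_near {a b c ε : ℝ} (hab : a < b) (hc : c ∈ Icc a b) (hε : 0 < ε) :
    ∃ t ∈ Icc a b, t ≠ c ∧ |t - c| < ε := by
  rcases hc.2.lt_or_eq with h | h
  · refine ⟨min b (c + ε / 2), ⟨le_min hab.le (by linarith [hc.1]), min_le_left _ _⟩, ?_, ?_⟩
    · exact (lt_min h (by linarith)).ne'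
    · rw [abs_of_nonneg (sub_nonneg.2 (le_min h.le (by linarith)))]
      linarith [min_le_right b (c + ε / 2)]
  · have h' : a < c := h ▸ hab
    refine ⟨max a (c - ε / 2), ⟨le_max_left _ _, max_le hab.le (by linarith [hc.2])⟩, ?_, ?_⟩
    · exact (max_lt h' (by linarith)).ne
    · rw [abs_of_nonpos (sub_nonpos.2 (max_le h'.le (by linarith)))]
      linarith [le_max_right a (c - ε / 2)]

/-- Near a straight wall only one kind of side passes through the point, so the candidates are the
old direction, which points outward, and its mirror image. -/
theorem Bounce.law {Ω : Set Plane} {q v w : Plane} (h : Bounce Ω q v w) :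
    q ∈ frontier Ω ∧ w ∈ reflections Ω q v ∧ IsInward Ω q w ∧
      ∀ w' ∈ reflections Ω q v, IsInward Ω q w' → w' = w := by
  rcases h with ⟨n, hn, h, rfl⟩ | ⟨n, hn, h, rfl⟩
  · have hn0 : n ≠ 0 := by rintro rfl; simp at hn
    have key := eventually_mem_interior_frontier (f := fun z : Plane => n * (z.1 - q.1))
      (by fun_prop) ((isOpenMap_mul_sub hn0 q.1).comp isOpenMap_fst) h
    have hin : ∀ u : Plane, IsInward Ω q u ↔ 0 < n * u.1 := by
      intro u
      rw [isInward_iff]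
      have h1 := (tendsto_add_smul q u).eventually key
      have h2 : ∀ᶠ t in 𝓝[>] (0 : ℝ), (q + t • u ∈ interior Ω ↔ 0 < n * u.1) := by
        filter_upwards [h1, self_mem_nhdsWithin] with t ht ht0
        rw [ht.1]
        have : n * ((q + t • u).1 - q.1) = t * (n * u.1) := by simp; ring
        rw [this, mul_pos_iff_of_pos_left ht0]
      rw [Filter.eventually_congr h2, Filter.eventually_const]
    obtain ⟨ε, hε, hk⟩ := Metric.eventually_nhds_iff.1 key
    have hv : OnVerticalSide Ω q := by
      refine ⟨q.2 - ε / 2, q.2 + ε / 2, by linarith, ⟨by linarith, by linarith⟩, fun t ht => ?_⟩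
      refine ((hk (y := (q.1, t)) ?_).2).2 (by simp)
      rw [Prod.dist_eq, max_lt_iff, dist_self, Real.dist_eq, abs_lt]
      exact ⟨hε, by linarith [ht.1], by linarith [ht.2]⟩
    have hh : ¬ OnHorizontalSide Ω q := by
      rintro ⟨a, b, hab, hq, hf⟩
      obtain ⟨t, ht, htq, htε⟩ := exists_mem_Icc_ne_near hab hq hε
      have := ((hk (y := (t, q.2)) (by
        rw [Prod.dist_eq, max_lt_iff, dist_self, Real.dist_eq]
        exact ⟨htε, hε⟩)).2).1 (hf t ht)
      exact (mul_ne_zero hn0 (sub_ne_zero.2 htq)) this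
    refine ⟨(key.self_of_nhds.2).2 (by simp), ⟨Or.inr ⟨hv, rfl⟩, Or.inl rfl⟩, (hin _).2 ?_, ?_⟩
    · simp only [mul_neg]; linarith
    · rintro u ⟨hu1, hu2⟩ hu
      rw [hin] at hu
      have e2 : u.2 = v.2 := hu2.resolve_right fun h => hh h.1
      rcases hu1 with hu1 | ⟨-, hu1⟩
      · rw [hu1] at hu; linarith
      · exact Prod.ext hu1 e2
  · have hn0 : n ≠ 0 := by rintro rfl; simp at hn
    have key := eventually_mem_interior_frontier (f := fun z : Plane => n * (z.2 - q.2))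
      (by fun_prop) ((isOpenMap_mul_sub hn0 q.2).comp isOpenMap_snd) h
    have hin : ∀ u : Plane, IsInward Ω q u ↔ 0 < n * u.2 := by
      intro u
      rw [isInward_iff]
      have h1 := (tendsto_add_smul q u).eventually key
      have h2 : ∀ᶠ t in 𝓝[>] (0 : ℝ), (q + t • u ∈ interior Ω ↔ 0 < n * u.2) := by
        filter_upwards [h1, self_mem_nhdsWithin] with t ht ht0
        rw [ht.1]
        have : n * ((q + t • u).2 - q.2) = t * (n * u.2) := by simp; ring
        rw [this, mul_pos_iff_of_pos_left ht0]
      rw [Filter.eventually_congr h2, Filter.eventually_const]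
    obtain ⟨ε, hε, hk⟩ := Metric.eventually_nhds_iff.1 key
    have hh : OnHorizontalSide Ω q := by
      refine ⟨q.1 - ε / 2, q.1 + ε / 2, by linarith, ⟨by linarith, by linarith⟩, fun t ht => ?_⟩
      refine ((hk (y := (t, q.2)) ?_).2).2 (by simp)
      rw [Prod.dist_eq, max_lt_iff, dist_self, Real.dist_eq, abs_lt]
      exact ⟨⟨by linarith [ht.1], by linarith [ht.2]⟩, hε⟩
    have hv : ¬ OnVerticalSide Ω q := by
      rintro ⟨a, b, hab, hq, hf⟩
      obtain ⟨t, ht, htq, htε⟩ := exists_mem_Icc_ne_near hab hq hε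
      have := ((hk (y := (q.1, t)) (by
        rw [Prod.dist_eq, max_lt_iff, dist_self, Real.dist_eq]
        exact ⟨hε, htε⟩)).2).1 (hf t ht)
      exact (mul_ne_zero hn0 (sub_ne_zero.2 htq)) this
    refine ⟨(key.self_of_nhds.2).2 (by simp), ⟨Or.inl rfl, Or.inr ⟨hh, rfl⟩⟩, (hin _).2 ?_, ?_⟩
    · simp only [mul_neg]; linarith
    · rintro u ⟨hu1, hu2⟩ hu
      rw [hin] at hu
      have e1 : u.1 = v.1 := hu1.resolve_right fun h => hv h.1
      rcases hu2 with hu2 | ⟨-, hu2⟩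
      · rw [hu2] at hu; linarith
      · exact Prod.ext e1 hu2

/-- The open flight of duration `t` from the state `s` stays in the interior of the table. -/
def OpenFlight (Ω : Set Plane) (s : State) (t : ℝ) : Prop :=
  ∀ u : ℝ, 0 < u → u < t → s.1 + u • s.2 ∈ interior Ω

theorem Bounce.step {Ω : Set Plane} {s : State} {t : ℝ} {w : Plane} (ht : 0 < t)
    (hf : OpenFlight Ω s t) (h : Bounce Ω (s.1 + t • s.2) s.2 w) :
    Step Ω s (s.1 + t • s.2, w) :=
  ⟨⟨t, ht, rfl, h.law.1, hf⟩, h.law.2.1, h.law.2.2.1, h.law.2.2.2⟩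

/-! ### Finite pieces of billiard trajectories -/

/-- The trajectory of `s₀` reaches the state `r`, possibly in mid-flight, along the path `P`, and
none of its collision points lies in `B`. -/
inductive Flow (Ω B : Set Plane) (s₀ : State) : Set Plane → State → Prop
  | start : Flow Ω B s₀ {s₀.1} s₀
  | fly {P : Set Plane} {r : State} {t : ℝ} : Flow Ω B s₀ P r → 0 < t → OpenFlight Ω r t →
      r.1 + t • r.2 ∈ interior Ω →
      Flow Ω B s₀ (P ∪ segment ℝ r.1 (r.1 + t • r.2)) (r.1 + t • r.2, r.2)
  | hit {P : Set Plane} {r : State} {t : ℝ} {w : Plane} : Flow Ω B s₀ P r → 0 < t →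
      OpenFlight Ω r t → Bounce Ω (r.1 + t • r.2) r.2 w → r.1 + t • r.2 ∉ B →
      Flow Ω B s₀ (P ∪ segment ℝ r.1 (r.1 + t • r.2)) (r.1 + t • r.2, w)

/-- The trajectory of `s₀` arrives at `q` in the direction `v` along the path `P`. -/
def Approach (Ω B : Set Plane) (s₀ : State) (P : Set Plane) (q v : Plane) : Prop :=
  ∃ (P' : Set Plane) (r : State) (t : ℝ), Flow Ω B s₀ P' r ∧ 0 < t ∧ OpenFlight Ω r t ∧
    q = r.1 + t • r.2 ∧ v = r.2 ∧ P = P' ∪ segment ℝ r.1 q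

theorem Approach.fly {Ω B P : Set Plane} {s₀ : State} {q v : Plane} (h : Approach Ω B s₀ P q v)
    (hq : q ∈ interior Ω) : Flow Ω B s₀ P (q, v) := by
  obtain ⟨P', r, t, hF, ht, hf, rfl, rfl, rfl⟩ := h
  exact hF.fly ht hf hq

theorem Approach.hit {Ω B P : Set Plane} {s₀ : State} {q v w : Plane} (h : Approach Ω B s₀ P q v)
    (hb : Bounce Ω q v w) (hq : q ∉ B) : Flow Ω B s₀ P (q, w) := by
  obtain ⟨P', r, t, hF, ht, hf, rfl, rfl, rfl⟩ := h
  exact hF.hit ht hf hb hq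

/-- The union of the first `k` segments of an orbit. -/
def orbitPath (Ω : Set Plane) (s₀ : State) (k : ℕ) : Set Plane :=
  {z | ∃ j < k, ∃ s r : State, orbit Ω s₀ j = some s ∧ orbit Ω s₀ (j + 1) = some r ∧
    z ∈ segment ℝ s.1 r.1}

theorem orbitPath_zero (Ω : Set Plane) (s₀ : State) : orbitPath Ω s₀ 0 = ∅ := by
  simp [orbitPath]

theorem orbitPath_succ {Ω : Set Plane} {s₀ s r : State} {k : ℕ} (hs : orbit Ω s₀ k = some s)
    (hr : orbit Ω s₀ (k + 1) = some r) :
    orbitPath Ω s₀ (k + 1) = orbitPath Ω s₀ k ∪ segment ℝ s.1 r.1 := by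
  ext z
  constructor
  · rintro ⟨j, hj, s', r', h1, h2, h3⟩
    rcases Nat.lt_succ_iff_lt_or_eq.1 hj with h | rfl
    · exact Or.inl ⟨j, h, s', r', h1, h2, h3⟩
    · rw [hs, Option.some_inj] at h1
      rw [hr, Option.some_inj] at h2
      exact Or.inr (h1 ▸ h2 ▸ h3)
  · rintro (⟨j, hj, h⟩ | h)
    · exact ⟨j, hj.trans (Nat.lt_succ_self k), h⟩
    · exact ⟨k, Nat.lt_succ_self k, s, r, hs, hr, h⟩

theorem segment_add_smul (a v : Plane) {t : ℝ} (ht : 0 ≤ t) :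
    segment ℝ a (a + t • v) = (fun u : ℝ => a + u • v) '' Icc 0 t := by
  rw [segment_eq_image']
  ext z
  constructor
  · rintro ⟨θ, hθ, rfl⟩
    refine ⟨θ * t, ⟨mul_nonneg hθ.1 ht, mul_le_of_le_one_left ht hθ.2⟩, ?_⟩
    simp [mul_smul]
  · rintro ⟨u, hu, rfl⟩
    rcases ht.eq_or_lt with rfl | h
    · obtain rfl : u = 0 := le_antisymm hu.2 hu.1
      exact ⟨0, by simp, by simp⟩
    · refine ⟨u / t, ⟨div_nonneg hu.1 ht, (div_le_one h).2 hu.2⟩, ?_⟩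
      simp only [add_sub_cancel_left, smul_smul]
      rw [div_mul_cancel₀ _ h.ne']

theorem segment_union_add_smul (a v : Plane) {t s : ℝ} (ht : 0 ≤ t) (hs : 0 ≤ s) :
    segment ℝ a (a + t • v) ∪ segment ℝ (a + t • v) (a + t • v + s • v) =
      segment ℝ a (a + (t + s) • v) := by
  rw [segment_add_smul a v ht, segment_add_smul _ v hs, segment_add_smul a v (add_nonneg ht hs)]
  ext z
  constructor
  · rintro (⟨u, hu, rfl⟩ | ⟨u, hu, rfl⟩)
    · exact ⟨u, ⟨hu.1, by linarith [hu.2]⟩, rfl⟩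
    · exact ⟨t + u, ⟨by linarith [hu.1], by linarith [hu.2]⟩, by simp [add_smul, add_assoc]⟩
  · rintro ⟨u, hu, rfl⟩
    rcases le_total u t with h | h
    · exact Or.inl ⟨u, ⟨hu.1, h⟩, rfl⟩
    · refine Or.inr ⟨u - t, ⟨by linarith, by linarith [hu.2]⟩, ?_⟩
      simp [sub_smul]

/-- The junction need be interior only when t > 0; for t = 0 it is the starting point itself, which
may be on the boundary. -/
theorem OpenFlight.trans {Ω : Set Plane} {a v : Plane} {t s : ℝ} (h : OpenFlight Ω (a, v) t)
    (hm : 0 < t → a + t • v ∈ interior Ω) (h' : OpenFlight Ω (a + t • v, v) s) :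
    OpenFlight Ω (a, v) (t + s) := by
  intro u hu hus
  rcases lt_trichotomy u t with hut | rfl | hut
  · exact h u hu hut
  · exact hm hu
  · have := h' (u - t) (by linarith) (by linarith)
    simpa [sub_smul] using this

/-- Mid-flight stops are artificial: the current state is the last collision state `q` followed by a
free flight of duration t, with t = 0 just after a collision. -/
theorem Flow.exists_orbit {Ω B P : Set Plane} {s₀ r : State} (h : Flow Ω B s₀ P r) :
    ∃ (k : ℕ) (q : State) (t : ℝ), orbit Ω s₀ k = some q ∧
      (∀ j, 0 < j → j ≤ k → ∀ s, orbit Ω s₀ j = some s → s.1 ∉ B) ∧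
      0 ≤ t ∧ OpenFlight Ω q t ∧ (0 < t → r.1 ∈ interior Ω) ∧ r.1 = q.1 + t • q.2 ∧ r.2 = q.2 ∧
      P = orbitPath Ω s₀ k ∪ segment ℝ q.1 r.1 := by
  induction h with
  | start =>
    refine ⟨0, s₀, 0, rfl, fun j hj hj' => absurd hj' (not_le.2 hj), le_rfl,
      fun u h1 h2 => absurd h1 (not_lt.2 h2.le), fun h => absurd h (lt_irrefl _), by simp, rfl, ?_⟩
    rw [orbitPath_zero, segment_same, empty_union]
  | @fly P r t hF ht hf hi ih =>
    obtain ⟨k, ⟨q, v⟩, t', hq, hB, ht', hf', hi', hr1, hr2, rfl⟩ := ih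
    obtain ⟨r1, r2⟩ := r
    dsimp only at hr1 hr2 hi hf hi' ⊢
    subst hr2 hr1
    refine ⟨k, (q, r2), t' + t, hq, hB, by linarith, hf'.trans hi' hf, fun _ => hi, ?_, rfl, ?_⟩
    · simp [add_smul, add_assoc]
    · rw [union_assoc, segment_union_add_smul q r2 ht' ht.le, add_smul, add_assoc]
  | @hit P r t w hF ht hf hb hqB ih =>
    obtain ⟨k, ⟨q, v⟩, t', hq, hB, ht', hf', hi', hr1, hr2, rfl⟩ := ih
    obtain ⟨r1, r2⟩ := r
    dsimp only at hr1 hr2 hf hi' hb hqB ⊢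
    subst hr2 hr1
    have e : q + t' • r2 + t • r2 = q + (t' + t) • r2 := by rw [add_smul, add_assoc]
    rw [e] at hb hqB ⊢
    have hst : Step Ω (q, r2) (q + (t' + t) • r2, w) :=
      Bounce.step (s := (q, r2)) (by linarith) (hf'.trans hi' hf) hb
    have hk : orbit Ω s₀ (k + 1) = some (q + (t' + t) • r2, w) := by
      rw [TFractal.orbit, hq, Option.bind_some, billiardMap_eq_some]
      exact hst
    refine ⟨k + 1, (q + (t' + t) • r2, w), 0, hk, ?_, le_rfl,
      fun u h1 h2 => absurd h1 (not_lt.2 h2.le), fun h => absurd h (lt_irrefl _), by simp, rfl, ?_⟩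
    · intro j hj hjk s hs
      rcases hjk.lt_or_eq with h | rfl
      · exact hB j hj (Nat.lt_succ_iff.1 h) s hs
      · rw [hk, Option.some_inj] at hs
        rw [← hs]
        exact hqB
    · rw [orbitPath_succ hq hk, ← e, union_assoc, segment_union_add_smul q r2 ht' ht.le, e,
        segment_same, union_assoc]
      congr 1
      rw [eq_comm, union_eq_left, singleton_subset_iff]
      exact right_mem_segment ℝ _ _

/-- The state in which a trajectory arrives at `q` is the last one of a finite piece of the
orbit. -/
theorem Approach.exists_orbit {Ω B P : Set Plane} {s₀ : State} {q v : Plane}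
    (h : Approach Ω B s₀ P q v) : ∃ (k : ℕ) (s : State) (t : ℝ), orbit Ω s₀ k = some s ∧
      (∀ j, 0 < j → j ≤ k → ∀ s, TFractal.orbit Ω s₀ j = some s → s.1 ∉ B) ∧
      0 < t ∧ OpenFlight Ω s t ∧ q = s.1 + t • s.2 ∧ v = s.2 ∧
      P = orbitPath Ω s₀ k ∪ segment ℝ s.1 q := by
  obtain ⟨P', ⟨r1, r2⟩, t, hF, ht, hf, rfl, rfl, rfl⟩ := h
  obtain ⟨k, ⟨a, v⟩, t', hq, hB, ht', hf', hi', hr1, hr2, rfl⟩ := hF.exists_orbit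
  dsimp only at hr1 hr2 hi' hf ⊢
  subst hr2 hr1
  refine ⟨k, (a, v), t' + t, hq, hB, by linarith, hf'.trans hi' hf, ?_, rfl, ?_⟩
  · simp [add_smul, add_assoc]
  · rw [union_assoc, segment_union_add_smul a v ht' ht.le, add_smul, add_assoc]

/-- The final collision is not required to avoid `B`; this is what allows it to be identified as the
first escape. -/
theorem Approach.exists_orbit_hit {Ω B P : Set Plane} {s₀ : State} {q v w : Plane}
    (h : Approach Ω B s₀ P q v) (hb : Bounce Ω q v w) :
    ∃ k : ℕ, TFractal.orbit Ω s₀ (k + 1) = some (q, w) ∧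
      (∀ j, 0 < j → j ≤ k → ∀ s, TFractal.orbit Ω s₀ j = some s → s.1 ∉ B) ∧
      P = orbitPath Ω s₀ (k + 1) := by
  obtain ⟨k, s, t, hs, hB, ht, hf, rfl, rfl, rfl⟩ := h.exists_orbit
  have hk : TFractal.orbit Ω s₀ (k + 1) = some (s.1 + t • s.2, w) := by
    rw [TFractal.orbit, hs, Option.bind_some, billiardMap_eq_some]
    exact hb.step ht hf
  exact ⟨k, hk, hB, (orbitPath_succ hs hk).symm⟩

theorem OpenFlight.segment_subset {Ω : Set Plane} {r : State} {t : ℝ} (hf : OpenFlight Ω r t)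
    (ht : 0 < t) (h0 : r.1 ∈ Ω) (h1 : r.1 + t • r.2 ∈ Ω) :
    segment ℝ r.1 (r.1 + t • r.2) ⊆ Ω := by
  rw [segment_add_smul _ _ ht.le]
  rintro _ ⟨u, hu, rfl⟩
  rcases hu.1.eq_or_lt with rfl | h2
  · simpa using h0
  rcases hu.2.eq_or_lt with rfl | h3
  · exact h1
  · exact interior_subset (hf u h2 h3)

theorem Flow.subset {Ω B P : Set Plane} {s₀ r : State} (h : Flow Ω B s₀ P r) (h0 : s₀.1 ∈ Ω) :
    r.1 ∈ Ω ∧ P ⊆ Ω := by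
  induction h with
  | start => exact ⟨h0, singleton_subset_iff.2 h0⟩
  | fly _ ht hf hi ih =>
    exact ⟨interior_subset hi, union_subset ih.2 (hf.segment_subset ht ih.1 (interior_subset hi))⟩
  | hit _ ht hf hb _ ih => exact ⟨hb.mem, union_subset ih.2 (hf.segment_subset ht ih.1 hb.mem)⟩

theorem Approach.subset {Ω B P : Set Plane} {s₀ : State} {q v : Plane}
    (h : Approach Ω B s₀ P q v) (h0 : s₀.1 ∈ Ω) (hq : q ∈ Ω) : P ⊆ Ω := by
  obtain ⟨P', r, t, hF, ht, hf, rfl, rfl, rfl⟩ := h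
  exact union_subset (hF.subset h0).2 (hf.segment_subset ht (hF.subset h0).1 hq)

theorem isClosed_segment (a b : Plane) : IsClosed (segment ℝ a b) := by
  rw [segment_eq_image']
  exact (isCompact_Icc.image (by fun_prop)).isClosed

theorem Flow.isClosed {Ω B P : Set Plane} {s₀ r : State} (h : Flow Ω B s₀ P r) : IsClosed P := by
  induction h with
  | start => exact isClosed_singleton
  | fly _ _ _ _ ih => exact ih.union (isClosed_segment _ _)
  | hit _ _ _ _ _ ih => exact ih.union (isClosed_segment _ _)

/-! ### The geometry of the prefractal tables -/

/-- The sign of a letter: `-1` on the left, `1` on the right. -/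
def Side.sign : Side → ℝ
  | Side.L => -1
  | Side.R => 1

theorem Side.sign_eq (a : Side) : a.sign = 1 ∨ a.sign = -1 := by cases a <;> simp [Side.sign]

theorem phi_eq (a : Side) (z : Plane) :
    phi a z = (z.1 / 2 + 1 / 4 + 3 / 4 * a.sign, z.2 / 2 + 3 / 2) := by
  cases a <;> simp only [phi, Side.sign] <;> congr 1 <;> ring

/-- The contraction `phi a` as a homeomorphism of the plane. -/
noncomputable def phiHomeomorph (a : Side) : Plane ≃ₜ Plane where
  toFun := phi a
  invFun z := (2 * (z.1 - 1 / 4 - 3 / 4 * a.sign), 2 * (z.2 - 3 / 2))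
  left_inv z := by rw [phi_eq]; ext <;> simp <;> ring
  right_inv z := by rw [phi_eq]; ext <;> simp; ring
  continuous_toFun := by
    have : phi a = fun z => (z.1 / 2 + 1 / 4 + 3 / 4 * a.sign, z.2 / 2 + 3 / 2) :=
      funext (phi_eq a)
    rw [this]; fun_prop
  continuous_invFun := by fun_prop

theorem phi_injective (a : Side) : Function.Injective (phi a) := (phiHomeomorph a).injective

theorem continuous_phi (a : Side) : Continuous (phi a) := (phiHomeomorph a).continuous

theorem mem_Phi {S : Set Plane} {z : Plane} : z ∈ Phi S ↔ ∃ a, z ∈ phi a '' S := by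
  constructor
  · rintro (h | h)
    · exact ⟨_, h⟩
    · exact ⟨_, h⟩
  · rintro ⟨a, h⟩
    cases a
    · exact Or.inl h
    · exact Or.inr h

theorem phi_mem_Phi {S : Set Plane} {z : Plane} (a : Side) (h : z ∈ S) : phi a z ∈ Phi S :=
  mem_Phi.2 ⟨a, mem_image_of_mem _ h⟩

theorem preTable_zero : preTable 0 = baseTable := by simp [preTable]

theorem mem_preTable {n : ℕ} {z : Plane} : z ∈ preTable n ↔ ∃ j ≤ n, z ∈ Phi^[j] baseTable := by
  simp [preTable]

theorem preTable_succ (n : ℕ) : preTable (n + 1) = baseTable ∪ Phi (preTable n) := by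
  ext z
  rw [mem_preTable, mem_union, mem_Phi]
  constructor
  · rintro ⟨j, hj, h⟩
    cases j with
    | zero => exact Or.inl h
    | succ j =>
      rw [Function.iterate_succ_apply', mem_Phi] at h
      obtain ⟨a, y, hy, rfl⟩ := h
      exact Or.inr ⟨a, y, mem_preTable.2 ⟨j, Nat.succ_le_succ_iff.1 hj, hy⟩, rfl⟩
  · rintro (h | ⟨a, y, hy, rfl⟩)
    · exact ⟨0, Nat.zero_le _, h⟩
    · obtain ⟨j, hj, hy⟩ := mem_preTable.1 hy
      refine ⟨j + 1, Nat.succ_le_succ hj, ?_⟩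
      rw [Function.iterate_succ_apply']
      exact phi_mem_Phi a hy

theorem mem_baseTable {z : Plane} : z ∈ baseTable ↔
    ((0 ≤ z.1 ∧ z.1 ≤ 1) ∧ 0 ≤ z.2 ∧ z.2 ≤ 1) ∨
      ((-(1 / 2) ≤ z.1 ∧ z.1 ≤ 3 / 2) ∧ 1 ≤ z.2 ∧ z.2 ≤ 3 / 2) := by
  simp only [baseTable, mem_union, mem_prod, mem_Icc]

/-- The strict bounds are the point: they keep the left and right copies on opposite sides of the
line x = 1/2 and keep every prefractal table below height 3, where the elusive points lie. -/
theorem preTable_bounds {n : ℕ} {z : Plane} (h : z ∈ preTable n) :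
    (-1 < z.1 ∧ z.1 < 2) ∧ 0 ≤ z.2 ∧ z.2 < 3 := by
  have base : ∀ {z : Plane}, z ∈ baseTable → (-1 < z.1 ∧ z.1 < 2) ∧ 0 ≤ z.2 ∧ z.2 < 3 := by
    intro z hz
    rcases mem_baseTable.1 hz with h | h
    · exact ⟨⟨by linarith, by linarith⟩, by linarith, by linarith⟩
    · exact ⟨⟨by linarith, by linarith⟩, by linarith, by linarith⟩
  induction n generalizing z with
  | zero => exact base (preTable_zero ▸ h)
  | succ n ih =>
    rw [preTable_succ] at h
    rcases h with h | h
    · exact base h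
    · obtain ⟨a, y, hy, rfl⟩ := mem_Phi.1 h
      obtain ⟨⟨h1, h2⟩, h3, h4⟩ := ih hy
      rw [phi_eq]
      rcases a.sign_eq with h | h <;> rw [h] <;>
        exact ⟨⟨by dsimp only; linarith, by dsimp only; linarith⟩, by dsimp only; linarith,
          by dsimp only; linarith⟩

theorem baseTable_subset_preTable (n : ℕ) : baseTable ⊆ preTable n := fun _ h =>
  mem_preTable.2 ⟨0, Nat.zero_le _, h⟩

theorem isCompact_preTable (n : ℕ) : IsCompact (preTable n) := by
  have base : IsCompact baseTable :=
    (isCompact_Icc.prod isCompact_Icc).union (isCompact_Icc.prod isCompact_Icc)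
  induction n with
  | zero => rwa [preTable_zero]
  | succ n ih =>
    rw [preTable_succ]
    exact base.union ((ih.image (continuous_phi _)).union (ih.image (continuous_phi _)))

theorem preTable_fst_bounds {n : ℕ} {z : Plane} (h : z ∈ preTable n) (h1 : z.2 < 1) :
    0 ≤ z.1 ∧ z.1 ≤ 1 := by
  cases n with
  | zero =>
    rw [preTable_zero, mem_baseTable] at h
    rcases h with h | h
    · exact h.1
    · linarith
  | succ n =>
    rw [preTable_succ] at h
    rcases h with h | h
    · rcases mem_baseTable.1 h with h | h
      · exact h.1
      · linarith
    · obtain ⟨a, y, hy, rfl⟩ := mem_Phi.1 h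
      have := (preTable_bounds hy).2.1
      rw [phi_eq] at h1
      dsimp only at h1
      linarith

/-- The base table ends at height 3/2, where the copies begin. -/
theorem baseTable_inter_Phi_preTable {n : ℕ} {z : Plane} (h : z ∈ baseTable)
    (h' : z ∈ Phi (preTable n)) : z ∈ removedSegments 0 := by
  obtain ⟨a, y, hy, rfl⟩ := mem_Phi.1 h'
  have h2 := (preTable_bounds hy).2.1
  have h3 : y.2 = 0 := by
    rcases mem_baseTable.1 h with h | h <;> rw [phi_eq] at h <;> dsimp only at h <;> linarith
  refine phi_mem_Phi a ?_
  have := preTable_fst_bounds hy (by rw [h3]; norm_num)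
  simp only [baseSegment, mem_prod, mem_Icc, mem_singleton_iff]
  exact ⟨this, h3⟩

/-- The attached copies form a closed set that meets the base table only in the removed segments. -/
theorem eventually_mem_preTable_iff_of_mem_baseTable {q : Plane} (hq : q ∈ baseTable)
    (hq' : q ∉ removedSegments 0) (n : ℕ) : ∀ᶠ z in 𝓝 q, (z ∈ preTable n ↔ z ∈ baseTable) := by
  cases n with
  | zero => rw [preTable_zero]; exact Eventually.of_forall fun _ => Iff.rfl
  | succ n =>
    have hc : IsClosed (Phi (preTable n)) := by
      have ih := isCompact_preTable n
      exact ((ih.image (continuous_phi _)).union (ih.image (continuous_phi _))).isClosed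
    have : q ∉ Phi (preTable n) := fun h => hq' (baseTable_inter_Phi_preTable hq h)
    filter_upwards [hc.isOpen_compl.mem_nhds this] with z hz
    rw [preTable_succ]
    exact ⟨fun h => h.resolve_right hz, Or.inl⟩

/-- The two contractions send the open strip -1 < x < 2 to disjoint strips, so the letters must
agree. -/
theorem mem_of_phi_mem_image {a b : Side} {S : Set Plane} {z : Plane}
    (hS : ∀ y ∈ S, -1 < y.1 ∧ y.1 < 2) (hz : -1 < z.1 ∧ z.1 < 2) (h : phi a z ∈ phi b '' S) :
    z ∈ S := by
  obtain ⟨y, hy, he⟩ := h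
  have hab : a = b := by
    have h1 := congrArg Prod.fst he
    rw [phi_eq, phi_eq] at h1
    dsimp only at h1
    have h2 := hS y hy
    cases a <;> cases b <;> simp only [Side.sign] at h1 <;> first | rfl | linarith
  subst hab
  exact phi_injective a he ▸ hy

theorem phi_mem_preTable_succ_iff {n : ℕ} {z : Plane} (a : Side) (hz : -1 < z.1 ∧ z.1 < 2)
    (hz' : 0 < z.2) : phi a z ∈ preTable (n + 1) ↔ z ∈ preTable n := by
  rw [preTable_succ]
  constructor
  · rintro (h | h)
    · rcases mem_baseTable.1 h with h | h <;> rw [phi_eq] at h <;> dsimp only at h <;> linarith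
    · obtain ⟨b, hb⟩ := mem_Phi.1 h
      exact mem_of_phi_mem_image (fun y hy => (preTable_bounds hy).1) hz hb
  · exact fun h => Or.inr (phi_mem_Phi a h)

/-! ### Lifting trajectories through a contraction to the next table -/

theorem eventually_nhds_phi {a : Side} {q : Plane} {p : Plane → Prop} :
    (∀ᶠ z in 𝓝 (phi a q), p z) ↔ ∀ᶠ z in 𝓝 q, p (phi a z) := by
  have := (phiHomeomorph a).map_nhds_eq q
  change map (phi a) (𝓝 q) = 𝓝 (phi a q) at this
  rw [← this, eventually_map]

theorem Bounce.phi {n : ℕ} {q v w : Plane} (a : Side) (h : Bounce (preTable n) q v w)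
    (hq : 0 < q.2) : Bounce (preTable (n + 1)) (phi a q) v w := by
  have hloc : ∀ᶠ z in 𝓝 q, (TFractal.phi a z ∈ preTable (n + 1) ↔ z ∈ preTable n) := by
    have hb := (preTable_bounds h.mem).1
    have h1 : ∀ᶠ z : Plane in 𝓝 q, -1 < z.1 := continuous_fst.continuousAt.eventually_const_lt hb.1
    have h2 : ∀ᶠ z : Plane in 𝓝 q, z.1 < 2 := continuous_fst.continuousAt.eventually_lt_const hb.2
    have h3 : ∀ᶠ z : Plane in 𝓝 q, 0 < z.2 := continuous_snd.continuousAt.eventually_const_lt hq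
    filter_upwards [h1, h2, h3] with z h1 h2 h3 using phi_mem_preTable_succ_iff a ⟨h1, h2⟩ h3
  rcases h with ⟨m, hm, h, hw⟩ | ⟨m, hm, h, hw⟩
  -- The contraction halves coordinate differences; the factor 2 compensates.
  · refine Or.inl ⟨2 * m, by linarith, ?_, hw⟩
    rw [eventually_nhds_phi]
    filter_upwards [hloc, h] with z h1 h2
    rw [h1, h2, phi_eq, phi_eq]
    dsimp only
    ring_nf
  · refine Or.inr ⟨2 * m, by linarith, ?_, hw⟩
    rw [eventually_nhds_phi]
    filter_upwards [hloc, h] with z h1 h2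
    rw [h1, h2, phi_eq, phi_eq]
    dsimp only
    ring_nf

theorem phi_mem_interior {n : ℕ} {z : Plane} (a : Side) (h : z ∈ interior (preTable n)) :
    phi a z ∈ interior (preTable (n + 1)) := by
  have h1 : phi a '' interior (preTable n) ⊆ interior (preTable (n + 1)) := by
    refine interior_maximal ?_ ((phiHomeomorph a).isOpenMap _ isOpen_interior)
    rintro _ ⟨y, hy, rfl⟩
    rw [preTable_succ]
    exact Or.inr (phi_mem_Phi a (interior_subset hy))
  exact h1 (mem_image_of_mem _ h)

theorem phi_add_smul (a : Side) (z v : Plane) (t : ℝ) :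
    phi a (z + t • v) = phi a z + (t / 2) • v := by
  rw [phi_eq, phi_eq]
  ext <;> simp <;> ring

theorem phi_image_segment (a : Side) (z v : Plane) {t : ℝ} (ht : 0 ≤ t) :
    phi a '' segment ℝ z (z + t • v) = segment ℝ (phi a z) (phi a z + (t / 2) • v) := by
  rw [segment_add_smul _ _ ht, segment_add_smul _ _ (by positivity), image_image]
  ext y
  constructor
  · rintro ⟨u, hu, rfl⟩
    exact ⟨u / 2, ⟨by linarith [hu.1], by linarith [hu.2]⟩, (phi_add_smul a z v u).symm⟩
  · rintro ⟨u, hu, rfl⟩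
    refine ⟨2 * u, ⟨by linarith [hu.1], by linarith [hu.2]⟩, ?_⟩
    dsimp only
    rw [phi_add_smul, mul_div_cancel_left₀ _ two_ne_zero]

/-- The direction is kept while lengths are halved, hence half the duration. -/
theorem OpenFlight.phi {n : ℕ} {r : State} {t : ℝ} (a : Side) (h : OpenFlight (preTable n) r t) :
    OpenFlight (preTable (n + 1)) (phi a r.1, r.2) (t / 2) := by
  intro u h1 h2
  have := phi_mem_interior a (h (2 * u) (by linarith) (by linarith))
  rwa [phi_add_smul, mul_div_cancel_left₀ _ two_ne_zero] at this

/-- The points of the base and of the segments to be removed: the trajectory of a base point does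
not collide there before its escape. -/
def exits (n : ℕ) : Set Plane := removedSegments n ∪ {z | z.2 = 0}

theorem removedSegments_succ (n : ℕ) : removedSegments (n + 1) = Phi (removedSegments n) :=
  Function.iterate_succ_apply' _ _ _

theorem mem_baseSegment {z : Plane} : z ∈ baseSegment ↔ (0 ≤ z.1 ∧ z.1 ≤ 1) ∧ z.2 = 0 := by
  simp only [baseSegment, mem_prod, mem_Icc, mem_singleton_iff]

theorem removedSegments_bounds {n : ℕ} {z : Plane} (h : z ∈ removedSegments n) :
    (-1 < z.1 ∧ z.1 < 2) ∧ 3 / 2 ≤ z.2 := by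
  induction n generalizing z with
  | zero =>
    obtain ⟨a, y, hy, rfl⟩ := mem_Phi.1 (show z ∈ Phi baseSegment from h)
    have := mem_baseSegment.1 hy
    rw [phi_eq]
    rcases a.sign_eq with h | h <;> rw [h] <;>
        exact ⟨⟨by dsimp only; linarith, by dsimp only; linarith⟩, by dsimp only; linarith⟩
  | succ n ih =>
    rw [removedSegments_succ] at h
    obtain ⟨a, y, hy, rfl⟩ := mem_Phi.1 h
    have := ih hy
    rw [phi_eq]
    rcases a.sign_eq with h | h <;> rw [h] <;>
        exact ⟨⟨by dsimp only; linarith, by dsimp only; linarith⟩, by dsimp only; linarith⟩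

theorem phi_notMem_exits {n : ℕ} {z : Plane} (a : Side) (hz : -1 < z.1 ∧ z.1 < 2)
    (hz' : 0 ≤ z.2) (h : z ∉ exits n) : phi a z ∉ exits (n + 1) := by
  rintro (h1 | h1)
  · rw [removedSegments_succ] at h1
    obtain ⟨b, hb⟩ := mem_Phi.1 h1
    exact h (Or.inl (mem_of_phi_mem_image (fun y hy => (removedSegments_bounds hy).1) hz hb))
  · rw [phi_eq, mem_ofPred_eq] at h1
    dsimp only at h1
    linarith

/-- Contracts a trajectory of table n into a copy inside table n + 1 and appends it to one that has
already reached its starting state. -/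
theorem Flow.phi {n : ℕ} {P P₀ : Set Plane} {s s₀ r : State} (a : Side)
    (h : Flow (preTable n) (exits n) s P r)
    (h₀ : Flow (preTable (n + 1)) (exits (n + 1)) s₀ P₀ (phi a s.1, s.2)) :
    Flow (preTable (n + 1)) (exits (n + 1)) s₀ (P₀ ∪ phi a '' P) (phi a r.1, r.2) := by
  induction h with
  | start =>
    rw [image_singleton]
    have : ∀ {P : Set Plane} {r : State}, Flow (preTable (n + 1)) (exits (n + 1)) s₀ P r →
        r.1 ∈ P := by
      intro P r h
      cases h with
      | start => exact mem_singleton _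
      | fly => exact Or.inr (right_mem_segment ℝ _ _)
      | hit => exact Or.inr (right_mem_segment ℝ _ _)
    rwa [union_eq_left.2 (singleton_subset_iff.2 (this h₀))]
  | @fly P r t _ ht hf hi ih =>
    rw [image_union, ← union_assoc, phi_image_segment a _ _ ht.le, phi_add_smul]
    refine ih.fly (t := t / 2) (by linarith) (hf.phi a) ?_
    dsimp only
    rw [← phi_add_smul]
    exact phi_mem_interior a hi
  | @hit P r t w _ ht hf hb hB ih =>
    rw [image_union, ← union_assoc, phi_image_segment a _ _ ht.le, phi_add_smul]
    have hm := preTable_bounds hb.mem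
    -- Collisions on the base line are excluded by `exits`; there the copy opens into the rest of
    -- the table and the local pictures differ.
    have hpos : 0 < (r.1 + t • r.2).2 := hm.2.1.lt_of_ne fun h => hB (Or.inr h.symm)
    refine ih.hit (t := t / 2) (by linarith) (hf.phi a) ?_ ?_
    · dsimp only
      rw [← phi_add_smul]
      exact hb.phi a hpos
    · dsimp only
      rw [← phi_add_smul]
      exact phi_notMem_exits a hm.1 hm.2.1 hB

theorem Approach.phi {n : ℕ} {P P₀ : Set Plane} {s s₀ : State} {q v : Plane} (a : Side)
    (h : Approach (preTable n) (exits n) s P q v)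
    (h₀ : Flow (preTable (n + 1)) (exits (n + 1)) s₀ P₀ (phi a s.1, s.2)) :
    Approach (preTable (n + 1)) (exits (n + 1)) s₀ (P₀ ∪ phi a '' P) (phi a q) v := by
  obtain ⟨P', r, t, hF, ht, hf, rfl, rfl, rfl⟩ := h
  refine ⟨_, _, t / 2, hF.phi a h₀, by linarith, hf.phi a, phi_add_smul _ _ _ _, rfl, ?_⟩
  rw [image_union, ← union_assoc, phi_image_segment a _ _ ht.le, phi_add_smul]

/-! ### From the base table to every prefractal table -/

theorem notMem_exits_of_mem_baseTable {q : Plane} (hq : q ∈ baseTable) (h : q ∉ exits 0) (n : ℕ) :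
    q ∉ exits n := by
  cases n with
  | zero => exact h
  | succ n =>
    rintro (h1 | h1)
    -- Segments removed at later stages have height at least 9/4, above the base table.
    · rw [removedSegments_succ] at h1
      obtain ⟨a, y, hy, rfl⟩ := mem_Phi.1 h1
      have := removedSegments_bounds hy
      rcases mem_baseTable.1 hq with h | h <;> rw [phi_eq] at h <;> dsimp only at h <;> linarith
    · exact h (Or.inr h1)

theorem interior_baseTable_subset (n : ℕ) : interior baseTable ⊆ interior (preTable n) :=
  interior_mono (baseTable_subset_preTable n)

theorem OpenFlight.preTable {r : State} {t : ℝ} (h : OpenFlight baseTable r t) (n : ℕ) :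
    OpenFlight (preTable n) r t := fun u h1 h2 => interior_baseTable_subset n (h u h1 h2)

/-- Collisions off the removed segments occur where table n coincides locally with the base table.
-/
theorem Flow.preTable {P : Set Plane} {s r : State} (h : Flow baseTable (exits 0) s P r) (n : ℕ) :
    Flow (preTable n) (exits n) s P r := by
  induction h with
  | start => exact Flow.start
  | fly _ ht hf hi ih => exact ih.fly ht (hf.preTable n) (interior_baseTable_subset n hi)
  | hit _ ht hf hb hB ih =>
    exact ih.hit ht (hf.preTable n)
      (hb.congr (eventually_mem_preTable_iff_of_mem_baseTable hb.mem (fun h => hB (Or.inl h)) n))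
      (notMem_exits_of_mem_baseTable hb.mem hB n)

theorem Approach.preTable {P : Set Plane} {s : State} {q v : Plane}
    (h : Approach baseTable (exits 0) s P q v) (n : ℕ) :
    Approach (preTable n) (exits n) s P q v := by
  obtain ⟨P', r, t, hF, ht, hf, rfl, rfl, rfl⟩ := h
  exact ⟨P', r, t, hF.preTable n, ht, hf.preTable n, rfl, rfl, rfl⟩

theorem mem_interior_of_rect {S : Set Plane} {a b c d : ℝ} {z : Plane}
    (hS : ∀ y : Plane, a < y.1 → y.1 < b → c < y.2 → y.2 < d → y ∈ S)
    (h : (a < z.1 ∧ z.1 < b) ∧ c < z.2 ∧ z.2 < d) : z ∈ interior S :=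
  mem_interior.2 ⟨Ioo a b ×ˢ Ioo c d, fun y hy => hS y hy.1.1 hy.1.2 hy.2.1 hy.2.2,
    isOpen_Ioo.prod isOpen_Ioo, h⟩

/-- The relatively open bases of the newly attached copies lie in the interior of the table. -/
theorem phi_base_mem_interior (n : ℕ) (a : Side) {x : ℝ} (hx : 0 < x) (hx' : x < 1) :
    phi a (x, 0) ∈ interior (preTable (n + 1)) := by
  refine mem_interior_of_rect (a := 1 / 4 + 3 / 4 * a.sign) (b := 3 / 4 + 3 / 4 * a.sign)
    (c := 1) (d := 2) ?_ ?_
  · intro y h1 h2 h3 h4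
    rw [preTable_succ]
    rcases le_total y.2 (3 / 2) with h | h
    · refine Or.inl (mem_baseTable.2 (Or.inr ?_))
      rcases a.sign_eq with h | h <;> rw [h] at h1 h2 <;>
        exact ⟨⟨by linarith, by linarith⟩, by linarith, by linarith⟩
    · refine Or.inr (mem_Phi.2 ⟨a, (2 * (y.1 - 1 / 4 - 3 / 4 * a.sign), 2 * (y.2 - 3 / 2)), ?_,
        (phiHomeomorph a).right_inv y⟩)
      refine baseTable_subset_preTable n (mem_baseTable.2 (Or.inl ?_))
      exact ⟨⟨by dsimp only; linarith, by dsimp only; linarith⟩, by dsimp only; linarith,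
        by dsimp only; linarith⟩
  · rw [phi_eq]
    exact ⟨⟨by dsimp only; linarith, by dsimp only; linarith⟩, by dsimp only; linarith,
        by dsimp only; linarith⟩

/-! ### Crossing a horizontal strip

The trajectories have slope `± 1 / p`; their directions are `(σ * C, τ * S)` with signs `σ`, `τ` and
with `C = p * S`. -/

/-- The coordinate u is measured from the midline in the direction of motion, so a change of height
h always increases it by p * h, whatever the signs σ and τ. -/
theorem add_smul_strip {p C S : ℝ} (hS : 0 < S) (hC : C = p * S) (σ τ u y h : ℝ) :
    ((1 / 2 + σ * u, y) : Plane) + (h / S) • ((σ * C, τ * S) : Plane) =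
      (1 / 2 + σ * (u + p * h), y + τ * h) := by
  subst hC
  ext
  · simp; field_simp; ring
  · simp; field_simp

theorem openFlight_strip {Ω : Set Plane} {r lo hi p C S : ℝ} (hS : 0 < S) (hp : 0 < p)
    (hC : C = p * S)
    (hint : ∀ x y, |x - 1 / 2| < r → lo < y → y < hi → ((x, y) : Plane) ∈ interior Ω)
    {u y h σ τ : ℝ} (hσ : σ = 1 ∨ σ = -1) (hτ : τ = 1 ∨ τ = -1) (hu : -r ≤ u)
    (hy : lo ≤ y) (hy' : y ≤ hi) (hz : lo ≤ y + τ * h) (hz' : y + τ * h ≤ hi)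
    (hr : u + p * h ≤ r) : OpenFlight Ω ((1 / 2 + σ * u, y), (σ * C, τ * S)) (h / S) := by
  intro w hw hw'
  have e := add_smul_strip hS hC σ τ u y (w * S)
  rw [mul_div_cancel_right₀ _ hS.ne'] at e
  dsimp only
  rw [e]
  rw [lt_div_iff₀ hS] at hw'
  have h1 : 0 < w * S := mul_pos hw hS
  have h2 : 0 < p * (w * S) := mul_pos hp h1
  have h3 : p * (w * S) < p * h := mul_lt_mul_of_pos_left hw' hp
  refine hint _ _ ?_ ?_ ?_
  · rw [add_sub_cancel_left, abs_mul]
    have : |σ| = 1 := by rcases hσ with rfl | rfl <;> simp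
    rw [this, one_mul, abs_lt]
    constructor <;> linarith
  · rcases hτ with rfl | rfl <;> linarith
  · rcases hτ with rfl | rfl <;> linarith

/-- A trajectory crosses the strip of width `2 * r` centred at `1 / 2` between two heights,
colliding `j` times with the vertical walls. -/
theorem exists_approach_strip {Ω B : Set Plane} {s₀ : State} {r lo hi p C S : ℝ} (hS : 0 < S)
    (hp : 0 < p) (hC : C = p * S)
    (hint : ∀ x y, |x - 1 / 2| < r → lo < y → y < hi → ((x, y) : Plane) ∈ interior Ω)
    (hwall : ∀ σ τ y, (σ = 1 ∨ σ = -1) → lo < y → y < hi →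
      Bounce Ω (1 / 2 + σ * r, y) (σ * C, τ * S) (-(σ * C), τ * S))
    (hB : ∀ x y, lo < y → y < hi → ((x, y) : Plane) ∉ B) (j : ℕ) :
    ∀ {P : Set Plane} {u y h σ τ : ℝ}, (σ = 1 ∨ σ = -1) → (τ = 1 ∨ τ = -1) → -r ≤ u → u < r →
      0 < h → lo ≤ y → y ≤ hi → lo ≤ y + τ * h → y + τ * h ≤ hi →
      -r < u + p * h - 2 * r * j → u + p * h - 2 * r * j ≤ r →
      Flow Ω B s₀ P ((1 / 2 + σ * u, y), (σ * C, τ * S)) →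
      ∃ P', Approach Ω B s₀ P' (1 / 2 + (-1) ^ j * σ * (u + p * h - 2 * r * j), y + τ * h)
        ((-1) ^ j * σ * C, τ * S) := by
  induction j with
  | zero =>
    intro P u y h σ τ hσ hτ hu hu' hh hy hy' hz hz' hr hr' hF
    simp only [Nat.cast_zero, mul_zero, sub_zero, pow_zero, one_mul] at hr hr' ⊢
    exact ⟨_, P, _, h / S, hF, div_pos hh hS,
      openFlight_strip hS hp hC hint hσ hτ hu hy hy' hz hz' hr',
      (add_smul_strip hS hC σ τ u y h).symm, rfl, rfl⟩
  | succ j ih =>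
    intro P u y h σ τ hσ hτ hu hu' hh hy hy' hz hz' hr hr' hF
    have hr0 : 0 < r := by linarith
    have hj : 0 ≤ r * (j : ℝ) := by positivity
    push_cast at hr hr'
    -- The change of height up to the first wall collision.
    set k := (r - u) / p with hk
    have hpk : p * k = r - u := by rw [hk]; field_simp
    have hk0 : 0 < k := div_pos (by linarith) hp
    have hkh : k < h := by
      have : p * k < p * h := by rw [hpk]; linarith
      exact lt_of_mul_lt_mul_left this hp.le
    have e := add_smul_strip hS hC σ τ u y k
    rw [hpk, add_sub_cancel] at e
    have hlo : lo < y + τ * k := by rcases hτ with rfl | rfl <;> linarith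
    have hhi : y + τ * k < hi := by rcases hτ with rfl | rfl <;> linarith
    have hF' := hF.hit (t := k / S) (w := (-(σ * C), τ * S)) (div_pos hk0 hS)
      (openFlight_strip hS hp hC hint hσ hτ hu hy hy' hlo.le hhi.le (by rw [hpk]; linarith))
      (by dsimp only; rw [e]; exact hwall σ τ _ hσ hlo hhi)
      (by dsimp only; rw [e]; exact hB _ _ hlo hhi)
    dsimp only at hF'
    rw [e] at hF'
    -- The collision reverses the orientation, so the wall at coordinate r becomes the wall at
    -- coordinate -r.
    have hF'' : Flow Ω B s₀ (P ∪ segment ℝ (1 / 2 + σ * u, y) (1 / 2 + σ * r, y + τ * k))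
        ((1 / 2 + -σ * -r, y + τ * k), (-σ * C, τ * S)) := by
      convert hF' using 3 <;> ring
    have e1 : -r + p * (h - k) - 2 * r * j = u + p * h - 2 * r * (j + 1) := by
      rw [mul_sub, hpk]; ring
    have hz1 : y + τ * k + τ * (h - k) = y + τ * h := by ring
    obtain ⟨P', hP'⟩ := ih (σ := -σ) (τ := τ) (u := -r) (h := h - k) (y := y + τ * k)
      (by rcases hσ with rfl | rfl <;> simp) hτ le_rfl (by linarith) (by linarith) hlo.le hhi.le
      (by rwa [hz1]) (by rwa [hz1]) (by rw [e1]; exact hr) (by rw [e1]; exact hr') hF''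
    refine ⟨P', ?_⟩
    rw [e1, hz1] at hP'
    convert hP' using 2
    · push_cast
      ring
    · ring

/-! ### The base table -/

theorem baseTable_interior_square {x y : ℝ} (hx : |x - 1 / 2| < 1 / 2) (hy : 0 < y)
    (hy' : y < 3 / 2) : ((x, y) : Plane) ∈ interior baseTable := by
  rw [abs_lt] at hx
  refine mem_interior_of_rect (a := 0) (b := 1) (c := 0) (d := 3 / 2) ?_
    ⟨⟨by dsimp only; linarith, by dsimp only; linarith⟩, hy, hy'⟩
  intro z h1 h2 h3 h4
  rw [mem_baseTable]
  rcases le_total z.2 1 with h | h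
  · exact Or.inl ⟨⟨h1.le, h2.le⟩, h3.le, h⟩
  · exact Or.inr ⟨⟨by linarith, by linarith⟩, h, h4.le⟩

theorem baseTable_interior_bar {x y : ℝ} (hx : |x - 1 / 2| < 1) (hy : 1 < y)
    (hy' : y < 3 / 2) : ((x, y) : Plane) ∈ interior baseTable := by
  rw [abs_lt] at hx
  refine mem_interior_of_rect (a := -(1 / 2)) (b := 3 / 2) (c := 1) (d := 3 / 2) ?_
    ⟨⟨by dsimp only; linarith, by dsimp only; linarith⟩, hy, hy'⟩
  intro z h1 h2 h3 h4
  exact mem_baseTable.2 (Or.inr ⟨⟨h1.le, h2.le⟩, h3.le, h4.le⟩)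

theorem eventually_rect {q : Plane} {a b c d : ℝ} (h1 : a < q.1) (h2 : q.1 < b) (h3 : c < q.2)
    (h4 : q.2 < d) : ∀ᶠ z : Plane in 𝓝 q, a < z.1 ∧ z.1 < b ∧ c < z.2 ∧ z.2 < d :=
  (continuous_fst.continuousAt.eventually_const_lt h1).and
    ((continuous_fst.continuousAt.eventually_lt_const h2).and
      ((continuous_snd.continuousAt.eventually_const_lt h3).and
        (continuous_snd.continuousAt.eventually_lt_const h4)))

theorem baseTable_bounce_square {C : ℝ} (hC : 0 < C) {σ y : ℝ} (hσ : σ = 1 ∨ σ = -1)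
    (hy : 0 < y) (hy' : y < 1) (c : ℝ) :
    Bounce baseTable (1 / 2 + σ * (1 / 2), y) (σ * C, c) (-(σ * C), c) := by
  refine Or.inl ⟨-σ, by rcases hσ with rfl | rfl <;> simpa using hC, ?_, rfl⟩
  filter_upwards [eventually_rect (q := (1 / 2 + σ * (1 / 2), y)) (a := σ * (1 / 2))
    (b := 1 + σ * (1 / 2)) (by dsimp only; linarith) (by dsimp only; linarith) hy hy']
    with z hz
  rw [mem_baseTable]
  rcases hσ with rfl | rfl
  · constructor
    · rintro (h | h) <;> linarith
    · intro h
      exact Or.inl ⟨⟨by linarith, by linarith⟩, by linarith, by linarith⟩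
  · constructor
    · rintro (h | h) <;> linarith
    · intro h
      exact Or.inl ⟨⟨by linarith, by linarith⟩, by linarith, by linarith⟩

theorem baseTable_bounce_bar {C : ℝ} (hC : 0 < C) {σ y : ℝ} (hσ : σ = 1 ∨ σ = -1)
    (hy : 1 < y) (hy' : y < 3 / 2) (c : ℝ) :
    Bounce baseTable (1 / 2 + σ * 1, y) (σ * C, c) (-(σ * C), c) := by
  refine Or.inl ⟨-σ, by rcases hσ with rfl | rfl <;> simpa using hC, ?_, rfl⟩
  filter_upwards [eventually_rect (q := (1 / 2 + σ * 1, y)) (a := σ) (b := 1 + σ)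
    (by dsimp only; linarith) (by dsimp only; linarith) hy hy'] with z hz
  rw [mem_baseTable]
  rcases hσ with rfl | rfl
  · constructor
    · rintro (h | h) <;> linarith
    · intro h
      exact Or.inr ⟨⟨by linarith, by linarith⟩, by linarith, by linarith⟩
  · constructor
    · rintro (h | h) <;> linarith
    · intro h
      exact Or.inr ⟨⟨by linarith, by linarith⟩, by linarith, by linarith⟩

theorem baseTable_bounce_top {S x : ℝ} (hS : 0 < S) (hx : |x - 1 / 2| < 1) (c : ℝ) :
    Bounce baseTable (x, 3 / 2) (c, S) (c, -S) := by
  rw [abs_lt] at hx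
  refine Or.inr ⟨-1, by simpa using hS, ?_, rfl⟩
  filter_upwards [eventually_rect (q := (x, 3 / 2)) (a := -(1 / 2)) (b := 3 / 2) (c := 1) (d := 2)
    (by dsimp only; linarith) (by dsimp only; linarith) (by norm_num) (by norm_num)] with z hz
  rw [mem_baseTable]
  constructor
  · rintro (h | h) <;> linarith
  · intro h
    exact Or.inr ⟨⟨by linarith, by linarith⟩, by linarith, by linarith⟩

theorem baseTable_bounce_ledge {S x : ℝ} (hS : 0 < S) (hx : 1 / 2 < |x - 1 / 2|)
    (hx' : |x - 1 / 2| < 1) (c : ℝ) : Bounce baseTable (x, 1) (c, -S) (c, S) := by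
  refine Or.inr ⟨1, by simpa using hS, ?_, by simp⟩
  have hc : Tendsto (fun z : Plane => |z.1 - 1 / 2|) (𝓝 (x, 1)) (𝓝 |x - 1 / 2|) :=
    Continuous.tendsto (by fun_prop) (x, 1)
  have h1 : ∀ᶠ z : Plane in 𝓝 (x, 1), 1 / 2 < |z.1 - 1 / 2| :=
    hc.eventually_const_lt hx
  have h2 : ∀ᶠ z : Plane in 𝓝 (x, 1), |z.1 - 1 / 2| < 1 :=
    hc.eventually_lt_const hx'
  have h3 : ∀ᶠ z : Plane in 𝓝 (x, 1), z.2 < 3 / 2 :=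
    continuous_snd.continuousAt.eventually_lt_const (by norm_num)
  filter_upwards [h1, h2, h3] with z h1 h2 h3
  rw [mem_baseTable]
  rw [abs_lt] at h2
  constructor
  · rintro (h | h)
    · have : |z.1 - 1 / 2| ≤ 1 / 2 := abs_le.2 ⟨by linarith, by linarith⟩
      linarith
    · linarith
  · intro h
    exact Or.inr ⟨⟨by linarith, by linarith⟩, by linarith, by linarith⟩

theorem notMem_exits_zero_of_lt {z : Plane} (h : 0 < z.2) (h' : z.2 < 3 / 2) : z ∉ exits 0 := by
  rintro (h1 | h1)
  · linarith [(removedSegments_bounds h1).2]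
  · exact h.ne' h1

/-- The bases of the two copies occupy only the outer quarters of the top side. -/
theorem notMem_exits_zero_of_top {x : ℝ} (hx : |x - 1 / 2| < 1 / 2) :
    ((x, 3 / 2) : Plane) ∉ exits 0 := by
  rw [abs_lt] at hx
  rintro (h1 | h1)
  · obtain ⟨a, y, hy, he⟩ := mem_Phi.1 (show _ ∈ Phi baseSegment from h1)
    have hy := mem_baseSegment.1 hy
    rw [phi_eq] at he
    have := congrArg Prod.fst he
    dsimp only at this
    rcases a.sign_eq with h | h <;> rw [h] at this <;> linarith
  · rw [mem_ofPred_eq] at h1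
    norm_num at h1

/-! ### One stage: from the base to the base of a copy -/

section Stage

variable {p j : ℕ} {C S e : ℝ}

theorem exists_approach_square {B : Set Plane} {s₀ : State} (hS : 0 < S) (hp : 0 < p)
    (hC : C = p * S) (hB : ∀ x y, 0 < y → y < 1 → ((x, y) : Plane) ∉ B) (k : ℕ) {P : Set Plane}
    {u σ : ℝ} (hσ : σ = 1 ∨ σ = -1) (hu : -(1 / 2) ≤ u) (hu' : u < 1 / 2)
    (h1 : -(1 / 2) < u + p - k) (h2 : u + p - k ≤ 1 / 2)
    (hF : Flow baseTable B s₀ P ((1 / 2 + σ * u, 0), (σ * C, S))) :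
    ∃ P', Approach baseTable B s₀ P' (1 / 2 + (-1) ^ k * σ * (u + p - k), 1)
      ((-1) ^ k * σ * C, S) := by
  have hp' : (0 : ℝ) < p := by exact_mod_cast hp
  have hC0 : 0 < C := by rw [hC]; positivity
  obtain ⟨P', h⟩ := exists_approach_strip (Ω := baseTable) (B := B) (s₀ := s₀) (r := 1 / 2)
    (lo := 0) (hi := 1) hS hp' hC
    (fun x y hx hy hy' => baseTable_interior_square hx hy (by linarith))
    (fun σ τ y hσ hy hy' => baseTable_bounce_square hC0 hσ hy hy' _)
    hB k (P := P) (u := u) (y := 0) (h := 1) (σ := σ) (τ := 1) hσ (Or.inl rfl) hu hu' one_pos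
    le_rfl zero_le_one (by norm_num) (by norm_num) (by linarith) (by linarith)
    (by rw [one_mul]; exact hF)
  refine ⟨P', ?_⟩
  convert h using 3 <;> ring

theorem exists_approach_bar {s₀ : State} (hS : 0 < S) (hp : 0 < p) (hC : C = p * S) (k : ℕ)
    {P : Set Plane} {u y y' σ τ : ℝ} (hσ : σ = 1 ∨ σ = -1)
    (hτ : τ = 1 ∧ y = 1 ∧ y' = 3 / 2 ∨ τ = -1 ∧ y = 3 / 2 ∧ y' = 1) (hu : -1 ≤ u) (hu' : u < 1)
    (h1 : -1 < u + p / 2 - 2 * k) (h2 : u + p / 2 - 2 * k ≤ 1)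
    (hF : Flow baseTable (exits 0) s₀ P ((1 / 2 + σ * u, y), (σ * C, τ * S))) :
    ∃ P', Approach baseTable (exits 0) s₀ P' (1 / 2 + (-1) ^ k * σ * (u + p / 2 - 2 * k), y')
      ((-1) ^ k * σ * C, τ * S) := by
  have hp' : (0 : ℝ) < p := by exact_mod_cast hp
  have hC0 : 0 < C := by rw [hC]; positivity
  have hy' : y' = y + τ * (1 / 2) := by
    rcases hτ with ⟨rfl, rfl, rfl⟩ | ⟨rfl, rfl, rfl⟩ <;> norm_num
  obtain ⟨P', h⟩ := exists_approach_strip (Ω := baseTable) (B := exits 0) (s₀ := s₀) (r := 1)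
    (lo := 1) (hi := 3 / 2) hS hp' hC
    (fun x y hx hy hy' => baseTable_interior_bar hx hy hy')
    (fun σ τ y hσ hy hy' => baseTable_bounce_bar hC0 hσ hy hy' _)
    (fun x y hy hy' => notMem_exits_zero_of_lt (by dsimp only; linarith) hy') k (P := P) (u := u)
    (y := y) (h := 1 / 2) (σ := σ) (τ := τ) hσ (hτ.imp And.left And.left) hu hu' (by norm_num)
    (by rcases hτ with ⟨rfl, rfl, rfl⟩ | ⟨rfl, rfl, rfl⟩ <;> norm_num)
    (by rcases hτ with ⟨rfl, rfl, rfl⟩ | ⟨rfl, rfl, rfl⟩ <;> norm_num)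
    (by rcases hτ with ⟨rfl, rfl, rfl⟩ | ⟨rfl, rfl, rfl⟩ <;> norm_num)
    (by rcases hτ with ⟨rfl, rfl, rfl⟩ | ⟨rfl, rfl, rfl⟩ <;> norm_num)
    (by linarith) (by linarith) hF
  refine ⟨P', ?_⟩
  rw [hy']
  convert h using 3
  ring

/-- A trajectory of slope `± 1 / p` that starts on the base of the base table at distance less than
`1 / 2` from its midpoint arrives, after one or three crossings of the upper rectangle, at the base
of one of the two copies to be attached. -/
theorem exists_approach_phi (hS : 0 < S) (hC : C = p * S) (he : e = 1 ∨ e = -1)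
    (hpj : (p : ℝ) = 4 * j + e) {u s σ : ℝ} (hσ : σ = 1 ∨ σ = -1) (hs : s = 1 ∨ s = -1)
    (hu : 0 < s * u) (hu' : s * u < 1 / 2) {a : Side} (ha : a.sign = -(-1) ^ j * e * σ) :
    ∃ P, Approach baseTable (exits 0) ((1 / 2 + σ * u, 0), (σ * C, S)) P
      (phi a (1 / 2 + -(-1) ^ j * e * σ * s * (2 * u - s / 2), 0))
      (-(-1) ^ j * e * σ * s * C, S) := by
  have hodd : Odd p := by
    rcases he with rfl | rfl
    · have : p = 4 * j + 1 := by exact_mod_cast hpj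
      exact ⟨2 * j, by omega⟩
    · have : p + 1 = 4 * j := by
        have : (p : ℝ) + 1 = 4 * j := by linarith
        exact_mod_cast this
      exact ⟨2 * j - 1, by omega⟩
  have hp : 0 < p := hodd.pos
  have hub : -(1 / 2) < u ∧ u < 1 / 2 := by
    rcases hs with rfl | rfl <;> constructor <;> linarith
  have hσ' : -σ = 1 ∨ -σ = -1 := by rcases hσ with rfl | rfl <;> simp
  have hη : ((-1 : ℝ) ^ j = 1 ∨ (-1 : ℝ) ^ j = -1) := neg_one_pow_eq_or ℝ j
  set s₀ : State := ((1 / 2 + σ * u, 0), (σ * C, S))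
  obtain ⟨P₁, A₁⟩ := exists_approach_square (B := exits 0) (s₀ := s₀) hS hp hC
    (fun x y hy hy' => notMem_exits_zero_of_lt hy (by dsimp only; linarith)) p hσ hub.1.le hub.2
    (by linarith) (by linarith) Flow.start
  -- After p wall collisions, p being odd, the coordinate is again u and the orientation is
  -- reversed.
  rw [hodd.neg_one_pow, add_sub_cancel_right, neg_one_mul] at A₁
  have F₁ := A₁.fly (baseTable_interior_square (by
    rw [add_sub_cancel_left, abs_mul, show |(-σ)| = 1 by rcases hσ' with h | h <;> simp [h],
      one_mul, abs_lt]; exact hub) one_pos (by norm_num))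
  obtain ⟨P₂, A₂⟩ := exists_approach_bar (u := u) (y := 1) (y' := 3 / 2) (τ := 1) hS hp hC j hσ'
    (Or.inl ⟨rfl, rfl, rfl⟩) (by linarith) (by linarith)
    (by rcases he with rfl | rfl <;> linarith) (by rcases he with rfl | rfl <;> linarith)
    (by rw [one_mul]; exact F₁)
  have e₂ : u + (p : ℝ) / 2 - 2 * j = u + e / 2 := by rw [hpj]; ring
  rw [e₂, one_mul] at A₂
  -- The first crossing ends at coordinate u + e/2. It exceeds 1/2 in absolute value, hence lies on
  -- the base of a copy, exactly when u has the sign of e.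
  rcases eq_or_ne s e with rfl | hse
  · refine ⟨P₂, ?_⟩
    rw [phi_eq, ha]
    convert A₂ using 2
    · rcases hs with rfl | rfl <;> (dsimp only; ring)
    · norm_num
    · rcases hs with rfl | rfl <;> ring
  · have hse : s = -e := by
      rcases hs with rfl | rfl <;> rcases he with rfl | rfl <;> first | exact absurd rfl hse | simp
    subst hse
    have F₂ := A₂.hit (w := ((-1) ^ j * -σ * C, -S)) (baseTable_bounce_top hS (by
        rw [abs_lt]
        rcases hη with h | h <;> rcases hσ with rfl | rfl <;> rcases he with rfl | rfl <;>
          rw [h] <;> constructor <;> linarith) _)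
      (notMem_exits_zero_of_top (by
        rw [abs_lt]
        rcases hη with h | h <;> rcases hσ with rfl | rfl <;> rcases he with rfl | rfl <;>
          rw [h] <;> constructor <;> linarith))
    obtain ⟨P₃, A₃⟩ := exists_approach_bar (u := u + e / 2) (σ := (-1) ^ j * -σ) (y := 3 / 2) (y' := 1) (τ := -1) hS hp hC j
      (by rcases hη with h | h <;> rcases hσ with rfl | rfl <;> rw [h] <;> norm_num)
      (Or.inr ⟨rfl, rfl, rfl⟩)
      (by rcases he with rfl | rfl <;> linarith) (by rcases he with rfl | rfl <;> linarith)
      (by rcases he with rfl | rfl <;> linarith) (by rcases he with rfl | rfl <;> linarith)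
      (by rw [neg_one_mul]; exact F₂)
    have e₃ : u + e / 2 + (p : ℝ) / 2 - 2 * j = u + e := by rw [hpj]; ring
    have e₃' : (-1 : ℝ) ^ j * ((-1) ^ j * -σ) = -σ := by
      rcases hη with h | h <;> rw [h] <;> ring
    rw [e₃, e₃', neg_one_mul] at A₃
    have F₃ := A₃.hit (w := (-σ * C, S)) (baseTable_bounce_ledge hS (by
        rw [lt_abs]
        rcases hσ with rfl | rfl <;> rcases he with rfl | rfl <;>
          first | (left; linarith) | (right; linarith)) (by
        rw [abs_lt]
        rcases hσ with rfl | rfl <;> rcases he with rfl | rfl <;>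
          constructor <;> linarith) _)
      (notMem_exits_zero_of_lt one_pos (by norm_num))
    -- The last crossing starts on a ledge at coordinate u + e, so it needs one wall collision more
    -- than the first one if e = 1 and one fewer if e = -1.
    obtain ⟨i, hi, hi'⟩ : ∃ i : ℕ, (i : ℝ) = j + e ∧ (-1 : ℝ) ^ i = -(-1) ^ j := by
      rcases he with rfl | rfl
      · exact ⟨j + 1, by push_cast; ring, by ring⟩
      · obtain ⟨i, rfl⟩ : ∃ i, j = i + 1 := by
          refine ⟨j - 1, ?_⟩
          have : (0 : ℝ) < j := by
            have : (0 : ℝ) ≤ p := by positivity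
            linarith
          have : 0 < j := by exact_mod_cast this
          omega
        exact ⟨i, by push_cast; ring, by ring⟩
    have e₄ : u + e + (p : ℝ) / 2 - 2 * i = u - e / 2 := by rw [hpj, hi]; ring
    obtain ⟨P₄, A₄⟩ := exists_approach_bar (u := u + e) (y := 1) (y' := 3 / 2) (τ := 1) hS hp hC i hσ'
      (Or.inl ⟨rfl, rfl, rfl⟩)
      (by rcases he with rfl | rfl <;> linarith) (by rcases he with rfl | rfl <;> linarith)
      (by rw [e₄]; rcases he with rfl | rfl <;> linarith)
      (by rw [e₄]; rcases he with rfl | rfl <;> linarith)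
      (by rw [one_mul]; exact F₃)
    rw [e₄, hi', one_mul] at A₄
    refine ⟨P₄, ?_⟩
    rw [phi_eq, ha]
    convert A₄ using 2
    · rcases he with rfl | rfl <;> (dsimp only; ring)
    · norm_num
    · rcases he with rfl | rfl <;> ring

end Stage

/-! ### The trajectory of a corner of the base -/

theorem mem_frontier_right_side {t : ℝ} (h : 0 ≤ t) (h' : t ≤ 1) :
    ((1, t) : Plane) ∈ frontier baseTable := by
  refine ⟨subset_closure (mem_baseTable.2 (Or.inl ⟨⟨by norm_num, by norm_num⟩, h, h'⟩)), fun hi => ?_⟩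
  -- Moving right and down leaves the table even from the corner (1, 1), where moving right alone
  -- would follow the ledge.
  have h1 := (tendsto_add_smul (1, t) (1, -1)).eventually (mem_interior_iff_mem_nhds.1 hi)
  obtain ⟨ε, hε, hε'⟩ := (h1.and self_mem_nhdsWithin).exists
  have hε' : 0 < ε := hε'
  rcases mem_baseTable.1 hε with h | h <;> simp at h <;> linarith

theorem isInward_reflex_corner {v : Plane} (hv : 0 < v.2) : IsInward baseTable (1, 1) v := by
  rw [isInward_iff]
  have h1 := (tendsto_add_smul (1, 1) v).eventually
    (eventually_rect (q := (1, 1)) (a := 0) (b := 3 / 2) (c := 0) (d := 3 / 2) (by norm_num)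
      (by norm_num) (by norm_num) (by norm_num))
  filter_upwards [h1, self_mem_nhdsWithin] with t ht ht0
  have h2 : 1 < ((1, 1) + t • v : Plane).2 := by
    have : 0 < t * v.2 := mul_pos ht0 hv
    simpa using this
  generalize ((1, 1) : Plane) + t • v = z at ht h2 ⊢
  exact baseTable_interior_bar (abs_lt.2 ⟨by linarith, by linarith⟩) h2 ht.2.2.2

theorem orbit_eq_none_of_le {Ω : Set Plane} {s : State} {k m : ℕ} (h : orbit Ω s k = none)
    (hkm : k ≤ m) : orbit Ω s m = none := by
  induction hkm with
  | refl => exact h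
  | step _ ih => rw [orbit, ih, Option.bind_none]

/-- The trajectory runs into the reflex corner (1, 1). There both the incoming direction and its
mirror image in the vertical side point inward, so no step exists. All earlier collisions have
positive height, so the orbit has not returned to its start. -/
theorem not_isPeriodicOrbit_corner {p : ℕ} (hp : Odd p) {C S : ℝ} (hS : 0 < S) (hC : C = p * S) :
    ¬ IsPeriodicOrbit baseTable ((0, 0), (C, S)) := by
  have hp0 : 0 < p := hp.pos
  have hC0 : 0 < C := by rw [hC]; positivity
  have hcast : ((p - 1 : ℕ) : ℝ) = p - 1 := by rw [Nat.cast_sub hp0, Nat.cast_one]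
  -- From coordinate -1/2, after p - 1 wall collisions, the coordinate at height 1 is exactly 1/2.
  obtain ⟨P, A⟩ := exists_approach_square (B := {z | z.2 = 0}) (s₀ := ((0, 0), (C, S)))
    (P := {(0, 0)}) (u := -(1 / 2)) (σ := 1) hS hp0 hC (fun x y hy _ => hy.ne') (p - 1)
    (Or.inl rfl) le_rfl (by norm_num) (by rw [hcast]; linarith) (by rw [hcast]; linarith) (by
      have := Flow.start (Ω := baseTable) (B := {z | z.2 = 0}) (s₀ := ((0, 0), (C, S)))
      convert this using 3 <;> norm_num)
  have hev : Even (p - 1) := Nat.Odd.sub_odd hp odd_one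
  rw [hcast, hev.neg_one_pow, one_mul, one_mul, one_mul] at A
  have ecorner : (1 / 2 + (-(1 / 2) + (p : ℝ) - (p - 1)), (1 : ℝ)) = ((1, 1) : Plane) := by
    ext
    · dsimp only; ring
    · rfl
  rw [ecorner] at A
  obtain ⟨k, s, t, hs, hB, ht, hf, hq, hv, -⟩ := A.exists_orbit
  have hnone : orbit baseTable ((0, 0), (C, S)) (k + 1) = none := by
    rw [orbit, hs, Option.bind_some, Option.eq_none_iff_forall_ne_some]
    intro r hr
    rw [billiardMap_eq_some] at hr
    obtain ⟨⟨t', ht', hr1, hfr, hf'⟩, hr2, -, hu⟩ := hr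
    have htt : t' = t := by
      rcases lt_trichotomy t' t with h | h | h
      · have := hf t' ht' h
        rw [← hr1] at this
        exact absurd this hfr.2
      · exact h
      · have := hf' t ht h
        rw [← hq] at this
        exact absurd this (mem_frontier_right_side zero_le_one le_rfl).2
    rw [htt, ← hq] at hr1
    rw [hr1, ← hv] at hu
    have hside : OnVerticalSide baseTable (1, 1) :=
      ⟨0, 1, zero_lt_one, ⟨zero_le_one, le_rfl⟩, fun t ht => mem_frontier_right_side ht.1 ht.2⟩
    have h1 := hu (C, S) ⟨Or.inl rfl, Or.inl rfl⟩ (isInward_reflex_corner hS)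
    have h2 := hu (-C, S) ⟨Or.inr ⟨hside, rfl⟩, Or.inl rfl⟩ (isInward_reflex_corner hS)
    have := congrArg Prod.fst (h1.trans h2.symm)
    dsimp only at this
    linarith
  rintro ⟨m, hm, hper⟩
  rcases Nat.lt_or_ge k m with h | h
  · rw [orbit_eq_none_of_le hnone h] at hper
    exact absurd hper (by simp)
  · exact hB m hm h _ hper rfl

/-! ### Addresses -/

/-- The definition adds letters on the inside; renormalization peels off the outermost one. -/
theorem phiWord_succ' (a : ℕ → Side) (n : ℕ) :
    phiWord a (n + 1) = phi (a 0) ∘ phiWord (fun m => a (m + 1)) n := by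
  induction n with
  | zero => rfl
  | succ n ih =>
    rw [phiWord, ih]
    rfl

theorem phiWord_eq (a : ℕ → Side) (n : ℕ) (z : Plane) :
    phiWord a n z = phiWord a n 0 + (1 / 2 : ℝ) ^ n • z := by
  induction n generalizing z with
  | zero => simp [phiWord]
  | succ n ih =>
    rw [phiWord, Function.comp_apply, Function.comp_apply, ih, ih (phi (a n) 0), add_assoc]
    congr 1
    rw [phi_eq, phi_eq]
    ext <;> simp <;> ring

theorem continuous_phiWord (a : ℕ → Side) (n : ℕ) : Continuous (phiWord a n) := by
  rw [funext (phiWord_eq a n)]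
  fun_prop

/-- The smallest rectangle with sides parallel to the axes that contains the table. -/
def boundingBox : Set Plane := Icc (-1) 2 ×ˢ Icc 0 3

theorem mem_boundingBox {z : Plane} :
    z ∈ boundingBox ↔ (-1 ≤ z.1 ∧ z.1 ≤ 2) ∧ 0 ≤ z.2 ∧ z.2 ≤ 3 := by
  simp only [boundingBox, mem_prod, mem_Icc]

theorem isCompact_boundingBox : IsCompact boundingBox := isCompact_Icc.prod isCompact_Icc

theorem preTable_subset_boundingBox (n : ℕ) : preTable n ⊆ boundingBox := by
  intro z hz
  obtain ⟨⟨h1, h2⟩, h3, h4⟩ := preTable_bounds hz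
  exact mem_boundingBox.2 ⟨⟨h1.le, h2.le⟩, h3, h4.le⟩

theorem phi_mem_boundingBox (b : Side) {z : Plane} (hz : z ∈ boundingBox) :
    phi b z ∈ boundingBox := by
  obtain ⟨⟨h1, h2⟩, h3, h4⟩ := mem_boundingBox.1 hz
  rw [phi_eq, mem_boundingBox]
  rcases b.sign_eq with h | h <;> rw [h] <;>
    exact ⟨⟨by dsimp only; linarith, by dsimp only; linarith⟩, by dsimp only; linarith,
      by dsimp only; linarith⟩

theorem antitone_phiWord_image_boundingBox (a : ℕ → Side) :
    Antitone fun n => phiWord a n '' boundingBox := by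
  refine antitone_nat_of_succ_le fun n => ?_
  rintro _ ⟨z, hz, rfl⟩
  exact ⟨phi (a n) z, phi_mem_boundingBox _ hz, rfl⟩

theorem phiWord_mem_boundingBox (a : ℕ → Side) (n : ℕ) {z : Plane} (hz : z ∈ boundingBox) :
    phiWord a n z ∈ boundingBox := by
  have h := antitone_phiWord_image_boundingBox a (Nat.zero_le n) (mem_image_of_mem _ hz)
  simpa [phiWord] using h

/-- Successive images of the origin differ by at most 2 · 2^-n, and the influence of the starting
point dies out like 2^-n. -/
theorem exists_hasAddress (a : ℕ → Side) : ∃ e, HasAddress e a := by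
  have hc : CauchySeq fun n => phiWord a n 0 := by
    refine cauchySeq_of_le_geometric (1 / 2) 2 (by norm_num) fun n => ?_
    rw [phiWord, Function.comp_apply, phiWord_eq a n (phi _ _), dist_self_add_right, norm_smul,
      mul_comm, Real.norm_of_nonneg (by positivity)]
    refine mul_le_mul_of_nonneg_right ?_ (by positivity)
    rw [phi_eq, Prod.norm_def, max_le_iff, Real.norm_eq_abs, Real.norm_eq_abs, abs_le, abs_le]
    rcases (a n).sign_eq with h | h <;> rw [h] <;> norm_num
  obtain ⟨e, he⟩ := cauchySeq_tendsto_of_complete hc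
  refine ⟨e, fun z => ?_⟩
  have h0 : Tendsto (fun n : ℕ => (1 / 2 : ℝ) ^ n • z) atTop (𝓝 ((0 : ℝ) • z)) :=
    (tendsto_pow_atTop_nhds_zero_of_lt_one (by norm_num) (by norm_num)).smul_const z
  rw [zero_smul] at h0
  have := he.add h0
  rw [add_zero] at this
  exact this.congr fun n => (phiWord_eq a n z).symm

section Address

variable {a : ℕ → Side} {e : Plane}

theorem HasAddress.mem_boundingBox (h : HasAddress e a) : e ∈ boundingBox :=
  isCompact_boundingBox.isClosed.mem_of_tendsto (h 0) (Eventually.of_forall fun n =>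
    phiWord_mem_boundingBox a n (TFractal.mem_boundingBox.2 (by norm_num)))

/-- Both contractions preserve the line at height 3, so the limit can be taken along a point of it.
-/
theorem HasAddress.snd_eq (h : HasAddress e a) : e.2 = 3 := by
  have h1 := (continuous_snd.tendsto e).comp (h (0, 3))
  have h2 : (Prod.snd ∘ fun n => phiWord a n (0, 3)) = fun _ => (3 : ℝ) := by
    have : ∀ (n : ℕ) (z : Plane), z.2 = 3 → (phiWord a n z).2 = 3 := by
      intro n
      induction n with
      | zero => exact fun z hz => hz
      | succ n ih =>
        intro z hz
        refine ih _ ?_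
        rw [phi_eq, hz]
        norm_num
    exact funext fun n => this n _ rfl
  rw [h2] at h1
  exact tendsto_nhds_unique h1 tendsto_const_nhds

theorem HasAddress.eq_phi {e' : Plane} (h : HasAddress e a)
    (h' : HasAddress e' fun m => a (m + 1)) : e = phi (a 0) e' := by
  have h1 := (h 0).comp (tendsto_add_atTop_nat 1)
  have h2 := ((continuous_phi (a 0)).tendsto e').comp (h' 0)
  refine tendsto_nhds_unique h1 (h2.congr fun n => ?_)
  rw [Function.comp_apply, Function.comp_apply, phiWord_succ', Function.comp_apply]

theorem phiWord_mem_preTable (a : ℕ → Side) (n : ℕ) {z : Plane} (hz : z ∈ baseTable) :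
    phiWord a n z ∈ preTable n := by
  induction n generalizing a with
  | zero => rw [preTable_zero]; exact hz
  | succ n ih =>
    rw [phiWord_succ', preTable_succ]
    exact Or.inr (phi_mem_Phi _ (ih _))

theorem HasAddress.mem_elusivePoints (h : HasAddress e a) : e ∈ elusivePoints := by
  constructor
  · refine mem_closure_of_tendsto (h 0) (Eventually.of_forall fun n => mem_iUnion.2 ⟨n, ?_⟩)
    exact phiWord_mem_preTable a n (mem_baseTable.2 (Or.inl (by norm_num)))
  · intro hm
    obtain ⟨n, hn⟩ := mem_iUnion.1 hm
    have := (preTable_bounds hn).2.2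
    rw [h.snd_eq] at this
    exact lt_irrefl _ this

theorem HasAddress.eventually_image_subset (h : HasAddress e a) {U : Set Plane} (hU : U ∈ 𝓝 e) :
    ∀ᶠ n in atTop, phiWord a n '' boundingBox ⊆ U := by
  obtain ⟨ε, hε, hεU⟩ := Metric.mem_nhds_iff.1 hU
  have h1 : ∀ᶠ n in atTop, dist (phiWord a n 0) e < ε / 2 :=
    Metric.tendsto_nhds.1 (h 0) (ε / 2) (by linarith)
  have h2 : Tendsto (fun n : ℕ => (1 / 2 : ℝ) ^ n * 3) atTop (𝓝 (0 * 3)) :=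
    (tendsto_pow_atTop_nhds_zero_of_lt_one (by norm_num) (by norm_num)).mul_const 3
  rw [zero_mul] at h2
  filter_upwards [h1, h2.eventually_lt_const (half_pos hε)] with n h1 h2
  rintro _ ⟨z, hz, rfl⟩
  refine hεU (Metric.mem_ball.2 ?_)
  have h3 : dist (phiWord a n z) (phiWord a n 0) ≤ (1 / 2 : ℝ) ^ n * 3 := by
    rw [phiWord_eq, dist_self_add_left, norm_smul, Real.norm_of_nonneg (by positivity)]
    refine mul_le_mul_of_nonneg_left ?_ (by positivity)
    obtain ⟨⟨h1, h2⟩, h3, h4⟩ := TFractal.mem_boundingBox.1 hz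
    rw [Prod.norm_def, max_le_iff, Real.norm_eq_abs, Real.norm_eq_abs, abs_le, abs_le]
    exact ⟨⟨by linarith, by linarith⟩, by linarith, by linarith⟩
  linarith [dist_triangle (phiWord a n z) (phiWord a n 0) e]

end Address

/-! ### Renormalization: from the base table to the prefractal tables -/

theorem phi_base_bounce {x c S : ℝ} (hS : 0 < S) (hx : 0 < x) (hx' : x < 1) (b : Side) :
    Bounce baseTable (phi b (x, 0)) (c, S) (c, -S) := by
  have h := baseTable_bounce_top (x := (phi b (x, 0)).1) hS (by
    rw [phi_eq, abs_lt]
    rcases b.sign_eq with h | h <;> rw [h] <;>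
      exact ⟨by dsimp only; linarith, by dsimp only; linarith⟩) c
  convert h using 1
  rw [phi_eq]
  ext
  · rfl
  · norm_num

/-- A sequence of base states, each of which is reached from the previous one by crossing the base
table and renormalizing the copy through the base of which the trajectory has left. -/
structure RenormalizedOrbit (s : ℕ → State) (a : ℕ → Side) (Q : ℕ → Set Plane) : Prop where
  pos : ∀ k, 0 < (s k).1.1
  lt_one : ∀ k, (s k).1.1 < 1
  snd_eq : ∀ k, (s k).1.2 = 0
  upward : ∀ k, 0 < (s k).2.2
  approach : ∀ k, Approach baseTable (exits 0) (s k) (Q k) (phi (a k) (s (k + 1)).1) (s (k + 1)).2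

section Renormalization

variable {s : ℕ → State} {a : ℕ → Side} {Q : ℕ → Set Plane}

theorem RenormalizedOrbit.tail (h : RenormalizedOrbit s a Q) :
    RenormalizedOrbit (fun k => s (k + 1)) (fun k => a (k + 1)) fun k => Q (k + 1) :=
  ⟨fun _ => h.pos _, fun _ => h.lt_one _, fun _ => h.snd_eq _, fun _ => h.upward _,
    fun _ => h.approach _⟩

theorem RenormalizedOrbit.eq_base (h : RenormalizedOrbit s a Q) (k : ℕ) :
    (s k).1 = ((s k).1.1, 0) := Prod.ext rfl (h.snd_eq k)

theorem RenormalizedOrbit.mem_baseTable (h : RenormalizedOrbit s a Q) (k : ℕ) :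
    (s k).1 ∈ baseTable := by
  refine TFractal.mem_baseTable.2 (Or.inl ⟨⟨(h.pos k).le, (h.lt_one k).le⟩, ?_, ?_⟩) <;>
    rw [h.snd_eq]
  norm_num

theorem RenormalizedOrbit.subset_boundingBox (h : RenormalizedOrbit s a Q) (k : ℕ) :
    Q k ⊆ boundingBox := by
  refine Subset.trans ?_ ((baseTable_subset_preTable 0).trans (preTable_subset_boundingBox 0))
  refine (h.approach k).subset (h.mem_baseTable k) ?_
  rw [h.eq_base]
  exact (phi_base_bounce (c := 0) (h.upward (k + 1)) (h.pos _) (h.lt_one _) _).mem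

theorem RenormalizedOrbit.isClosed (h : RenormalizedOrbit s a Q) (k : ℕ) : IsClosed (Q k) := by
  obtain ⟨P', r, t, hF, -, -, -, -, hP⟩ := h.approach k
  rw [hP]
  exact hF.isClosed.union (isClosed_segment _ _)

theorem biUnion_le_succ' (f : ℕ → Set Plane) (n : ℕ) :
    ⋃ i ≤ n + 1, f i = f 0 ∪ ⋃ i ≤ n, f (i + 1) := by
  ext z
  simp only [mem_iUnion, mem_union, exists_prop]
  constructor
  · rintro ⟨i, hi, hz⟩
    cases i with
    | zero => exact Or.inl hz
    | succ i => exact Or.inr ⟨i, Nat.succ_le_succ_iff.1 hi, hz⟩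
  · rintro (hz | ⟨i, hi, hz⟩)
    · exact ⟨0, Nat.zero_le _, hz⟩
    · exact ⟨i + 1, Nat.succ_le_succ hi, hz⟩

/-- Induction over all renormalized orbits: cross the base table, pass through the base of the first
copy, which is interior to table n + 1, and append the contracted trajectory of the tail in table n.
At the end the segment is still a wall of table n, whence the bounce. -/
theorem RenormalizedOrbit.exists_approach (n : ℕ) : ∀ {s : ℕ → State} {a : ℕ → Side}
    {Q : ℕ → Set Plane}, RenormalizedOrbit s a Q →
      Approach (preTable n) (exits n) (s 0) (⋃ i ≤ n, phiWord a i '' Q i)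
        (phiWord a (n + 1) (s (n + 1)).1) (s (n + 1)).2 ∧
      Bounce (preTable n) (phiWord a (n + 1) (s (n + 1)).1) (s (n + 1)).2
        ((s (n + 1)).2.1, -(s (n + 1)).2.2) ∧
      phiWord a (n + 1) (s (n + 1)).1 ∈ removedSegments n := by
  induction n with
  | zero =>
    intro s a Q h
    have e : ⋃ i ≤ 0, phiWord a i '' Q i = Q 0 := by
      simp [phiWord]
    rw [e, preTable_zero]
    refine ⟨h.approach 0, ?_, phi_mem_Phi _ ?_⟩
    · have := phi_base_bounce (c := (s 1).2.1) (h.upward 1) (h.pos 1) (h.lt_one 1) (a 0)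
      rw [← h.eq_base] at this
      exact this
    · exact mem_baseSegment.2 ⟨⟨(h.pos 1).le, (h.lt_one 1).le⟩, h.snd_eq 1⟩
  | succ n ih =>
    intro s a Q h
    obtain ⟨hA, hB, hR⟩ := ih h.tail
    have hpos : 0 < (phiWord (fun m => a (m + 1)) (n + 1) (s (n + 2)).1).2 :=
      lt_of_lt_of_le (by norm_num) (removedSegments_bounds hR).2
    rw [phiWord_succ' a (n + 1)]
    refine ⟨?_, hB.phi (a 0) hpos, ?_⟩
    · have hF : Flow (preTable (n + 1)) (exits (n + 1)) (s 0) (Q 0)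
          (phi (a 0) (s 1).1, (s 1).2) := by
        refine ((h.approach 0).preTable (n + 1)).fly ?_
        rw [h.eq_base]
        exact phi_base_mem_interior n _ (h.pos _) (h.lt_one _)
      have := hA.phi (a 0) hF
      rw [image_iUnion₂] at this
      rw [biUnion_le_succ', phiWord, image_id]
      simp only [phiWord_succ' a, image_comp]
      exact this
    · rw [removedSegments_succ]
      exact phi_mem_Phi _ hR

variable {X : ℕ → Plane} {θ : ℝ}

/-- All collisions before the final one avoid `exits n`, and the final one lies on a removed
segment. -/
theorem RenormalizedOrbit.firstEscape (h : RenormalizedOrbit s a Q) (hX : ∀ n, X n = (s 0).1)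
    (hθ : direction θ = (s 0).2) (n : ℕ) : ∃ k : ℕ, firstEscapeTime X θ n = k ∧
      orbitAt X θ n k = some (phiWord a (n + 1) (s (n + 1)).1,
        ((s (n + 1)).2.1, -(s (n + 1)).2.2)) ∧
      pathToEscape X θ n = ⋃ i ≤ n, phiWord a i '' Q i := by
  obtain ⟨hA, hB, hR⟩ := h.exists_approach n
  obtain ⟨k, hk, hav, hP⟩ := hA.exists_orbit_hit hB
  have ho : orbitAt X θ n = orbit (preTable n) (s 0) := by
    unfold orbitAt
    rw [hX, hθ]
  have hτ : firstEscapeTime X θ n = (k + 1 : ℕ) := by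
    refine le_antisymm (iInf₂_le (k + 1) ⟨Nat.succ_pos k, _, by rw [ho]; exact hk, hR⟩) ?_
    refine le_iInf₂ fun m hm => ?_
    obtain ⟨hm0, r, hr, hrB⟩ := hm
    rw [ho] at hr
    rw [Nat.cast_le]
    by_contra hlt
    exact hav m hm0 (by omega) r hr (Or.inl hrB)
  refine ⟨k + 1, hτ, by rw [ho]; exact hk, ?_⟩
  rw [hP]
  unfold pathToEscape orbitPath
  rw [hτ, ho]
  simp only [Nat.cast_lt]

/-- Every later piece of the path lies in the box contracted by the first n + 1 letters. This box is
closed, so it also contains what the closure adds, and it shrinks to e. -/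
theorem RenormalizedOrbit.converges (h : RenormalizedOrbit s a Q) (hX : ∀ n, X n = (s 0).1)
    (hθ : direction θ = (s 0).2) (hc : IsCompatibleSequence X θ) {e : Plane}
    (he : HasAddress e a) : NontrivialPathConvergesTo X θ e := by
  have hesc := h.firstEscape hX hθ
  refine ⟨hc, fun n => ?_, he.mem_elusivePoints, ?_, fun U hU => ?_⟩
  · obtain ⟨k, hk, -⟩ := hesc n
    rw [hk]
    exact ENat.natCast_ne_top k
  · refine ⟨fun n => (phiWord a (n + 1) (s (n + 1)).1, ((s (n + 1)).2.1, -(s (n + 1)).2.2)),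
      fun n => ?_, ?_⟩
    · obtain ⟨k, hk, ho, -⟩ := hesc n
      rw [hk, ENat.toNat_natCast]
      exact ho
    · refine fun U hU => ?_
      have := (tendsto_add_atTop_nat 1).eventually (he.eventually_image_subset hU)
      refine mem_map.2 ?_
      filter_upwards [this] with n hn
      refine hn (mem_image_of_mem _ (preTable_subset_boundingBox 0 ?_))
      rw [preTable_zero]
      exact h.mem_baseTable _
  · have := (tendsto_add_atTop_nat 1).eventually (he.eventually_image_subset hU)
    filter_upwards [this] with n hn
    rintro z ⟨hz, hzn⟩
    have hpath : ∀ m, pathToEscape X θ m = ⋃ i ≤ m, phiWord a i '' Q i := fun m => by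
      obtain ⟨k, -, -, hp⟩ := hesc m
      exact hp
    have hcl : nontrivialPath X θ ⊆ pathToEscape X θ n ∪ phiWord a (n + 1) '' boundingBox := by
      refine closure_minimal ?_ (IsClosed.union ?_
        (isCompact_boundingBox.image (continuous_phiWord a _)).isClosed)
      · refine iUnion_subset fun m => ?_
        rw [hpath, hpath]
        refine iUnion₂_subset fun i _ => ?_
        rcases le_or_gt i n with hin | hin
        · exact subset_union_of_subset_left (subset_biUnion_of_mem (s := Iic n)
            (u := fun i => phiWord a i '' Q i) hin) _
        · exact subset_union_of_subset_right ((image_mono (h.subset_boundingBox i)).trans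
            (antitone_phiWord_image_boundingBox a hin)) _
      · rw [hpath]
        refine (finite_Iic n).isClosed_biUnion fun i _ => ?_
        exact ((isCompact_boundingBox.of_isClosed_subset (h.isClosed i)
          (h.subset_boundingBox i)).image (continuous_phiWord a i)).isClosed
    exact hn ((hcl hz).resolve_left hzn)

end Renormalization

/-! ### Compatible sequences that start on the base -/

theorem base_mem_frontier (n : ℕ) {x : ℝ} (hx : 0 ≤ x) (hx' : x ≤ 1) :
    ((x, 0) : Plane) ∈ frontier (preTable n) := by
  refine ⟨subset_closure (baseTable_subset_preTable n (mem_baseTable.2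
    (Or.inl ⟨⟨hx, hx'⟩, le_rfl, zero_le_one⟩))), fun hi => ?_⟩
  have h1 := (tendsto_add_smul (x, 0) (0, -1)).eventually (mem_interior_iff_mem_nhds.1 hi)
  obtain ⟨ε, hε, hε'⟩ := (h1.and self_mem_nhdsWithin).exists
  have hε' : 0 < ε := hε'
  have := (preTable_bounds hε).2.1
  simp at this
  linarith

theorem isInward_base (n : ℕ) {x : ℝ} (hx : 0 < x) (hx' : x < 1) {v : Plane} (hv : 0 < v.2) :
    IsInward (preTable n) (x, 0) v := by
  rw [isInward_iff]
  have h1 := (tendsto_add_smul (x, 0) v).eventually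
    (eventually_rect (q := (x, 0)) (a := 0) (b := 1) (c := -1) (d := 1) hx hx' (by norm_num)
      (by norm_num))
  filter_upwards [h1, self_mem_nhdsWithin] with t ht ht0
  have h2 : 0 < ((x, 0) + t • v : Plane).2 := by
    have : 0 < t * v.2 := mul_pos ht0 hv
    simpa using this
  generalize ((x, 0) : Plane) + t • v = z at ht h2 ⊢
  exact interior_baseTable_subset n
    (baseTable_interior_square (abs_lt.2 ⟨by linarith, by linarith⟩) h2 (by linarith))

theorem isCompatibleSequence_base {X : ℕ → Plane} {θ x : ℝ} (hX : ∀ n, X n = (x, 0)) (hx : 0 < x)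
    (hx' : x < 1) (hθ : 0 < Real.sin θ) : IsCompatibleSequence X θ := by
  -- All basepoints coincide, so a segment of length zero serves.
  refine ⟨fun n => ?_, fun m n _ => ⟨(x, 0), 0, ?_⟩⟩
  · rw [hX]
    refine ⟨base_mem_frontier n hx.le hx'.le, fun h => ?_, isInward_base n hx hx' hθ⟩
    have := (removedSegments_bounds h).2
    norm_num at this
  · rw [zero_smul, add_zero, segment_same, hX, hX]
    exact ⟨rfl, rfl, inter_eq_left.2 (singleton_subset_iff.2 (base_mem_frontier n hx.le hx'.le))⟩

/-- The base lies on the boundary of every table, so the segment through `X 0` already meets that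
boundary there. -/
theorem IsCompatibleSequence.eq_base {X : ℕ → Plane} {θ x : ℝ} (h : IsCompatibleSequence X θ)
    (hX : X 0 = (x, 0)) (hx : 0 ≤ x) (hx' : x ≤ 1) (n : ℕ) : X n = (x, 0) := by
  cases n with
  | zero => exact hX
  | succ n =>
    obtain ⟨c, t, h0, -, hs⟩ := h.2 0 (n + 1) (Nat.succ_pos n)
    rw [hX] at h0
    have : ((x, 0) : Plane) ∈ ({X (n + 1)} : Set Plane) :=
      hs ▸ ⟨h0, base_mem_frontier _ hx hx'⟩
    exact (mem_singleton_iff.1 this).symm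

/-! ### Addresses of the same point -/

theorem IsPreperiodic.of_tail {a : ℕ → Side} (h : IsPreperiodic fun n => a (n + 1)) :
    IsPreperiodic a := by
  obtain ⟨N, q, hq, h⟩ := h
  refine ⟨N + 1, q, hq, fun n hn => ?_⟩
  obtain ⟨n, rfl⟩ : ∃ m, n = m + 1 := ⟨n - 1, by omega⟩
  rw [add_right_comm]
  exact h n (by omega)

/-- The extreme points of the set of elusive points have constant addresses. -/
theorem HasAddress.eq_of_extreme {b : Side} (k : ℕ) : ∀ {e : Plane} {a : ℕ → Side},
    HasAddress e a → e.1 = 1 / 2 + 3 / 2 * b.sign → a k = b := by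
  have key : ∀ {e : Plane} {a : ℕ → Side}, HasAddress e a → e.1 = 1 / 2 + 3 / 2 * b.sign →
      a 0 = b ∧ ∃ e', HasAddress e' (fun m => a (m + 1)) ∧ e'.1 = 1 / 2 + 3 / 2 * b.sign := by
    intro e a h he
    obtain ⟨e', he'⟩ := exists_hasAddress fun m => a (m + 1)
    have h1 := congrArg Prod.fst (h.eq_phi he')
    have h2 := (TFractal.mem_boundingBox.1 he'.mem_boundingBox).1
    rw [phi_eq, he] at h1
    dsimp only at h1
    have h3 : a 0 = b := by
      revert h1
      cases a 0 <;> cases b <;> simp only [Side.sign, imp_true_iff] <;> intro h1 <;> linarith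
    refine ⟨h3, e', he', ?_⟩
    rw [h3] at h1
    linarith
  induction k with
  | zero => exact fun h he => (key h he).1
  | succ k ih =>
    intro e a h he
    obtain ⟨-, e', h', he'⟩ := key h he
    exact ih h' he'

/-- A point with two different addresses has only preperiodic ones. -/
theorem HasAddress.isPreperiodic_of_ne (k : ℕ) : ∀ {e : Plane} {a a' : ℕ → Side},
    HasAddress e a → HasAddress e a' → a k ≠ a' k → IsPreperiodic a := by
  have base : ∀ {e : Plane} {a a' : ℕ → Side}, HasAddress e a → HasAddress e a' → a 0 ≠ a' 0 →
      IsPreperiodic a := by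
    intro e a a' h h' hne
    obtain ⟨e₁, he₁⟩ := exists_hasAddress fun m => a (m + 1)
    obtain ⟨e₂, he₂⟩ := exists_hasAddress fun m => a' (m + 1)
    have h1 := congrArg Prod.fst ((h.eq_phi he₁).symm.trans (h'.eq_phi he₂))
    rw [phi_eq, phi_eq] at h1
    dsimp only at h1
    have b1 := (TFractal.mem_boundingBox.1 he₁.mem_boundingBox).1
    have b2 := (TFractal.mem_boundingBox.1 he₂.mem_boundingBox).1
    -- The left and right images of the bounding box meet only on x = 1/2, which forces the tail to
    -- address an extreme point.
    obtain ⟨b, hb⟩ : ∃ b : Side, e₁.1 = 1 / 2 + 3 / 2 * b.sign := by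
      revert h1 hne
      cases a 0 <;> cases a' 0 <;> simp only [Side.sign, ne_eq, not_true_eq_false,
        false_imp_iff] <;> intro _ h1
      · exact ⟨Side.R, by simp only; linarith⟩
      · exact ⟨Side.L, by simp only; linarith⟩
    refine IsPreperiodic.of_tail ⟨0, 1, one_pos, fun n _ => ?_⟩
    exact (he₁.eq_of_extreme (n + 1) hb).trans (he₁.eq_of_extreme n hb).symm
  induction k with
  | zero => exact base
  | succ k ih =>
    intro e a a' h h' hne
    rcases ne_or_eq (a 0) (a' 0) with h0 | h0
    · exact base h h' h0
    · obtain ⟨e₁, he₁⟩ := exists_hasAddress fun m => a (m + 1)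
      obtain ⟨e₂, he₂⟩ := exists_hasAddress fun m => a' (m + 1)
      have h1 := (h.eq_phi he₁).symm.trans (h'.eq_phi he₂)
      rw [h0] at h1
      have h2 := phi_injective _ h1
      subst h2
      exact IsPreperiodic.of_tail (ih he₁ he₂ hne)

theorem HasAddress.isRational_iff {e : Plane} {a : ℕ → Side} (h : HasAddress e a) :
    IsRationalElusivePoint e ↔ IsPreperiodic a := by
  refine ⟨?_, fun ha => ⟨h.mem_elusivePoints, a, h, ha⟩⟩
  rintro ⟨-, a', h', ha'⟩
  by_cases heq : ∀ k, a k = a' k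
  · rwa [funext heq]
  · obtain ⟨k, hk⟩ := not_forall.1 heq
    exact h.isPreperiodic_of_ne k h' hk

/-- Opposite first letters shift the abscissae apart by 3/2, equal second letters cancel, and the
remaining tails contribute at most 3/4. -/
theorem HasAddress.ne_of_zero_of_one {e e' : Plane} {a a' : ℕ → Side} (h : HasAddress e a)
    (h' : HasAddress e' a') (h0 : (a 0).sign = -(a' 0).sign) (h1 : (a 1).sign = (a' 1).sign) :
    e ≠ e' := by
  obtain ⟨e₁, he₁⟩ := exists_hasAddress fun m => a (m + 1)
  obtain ⟨e₂, he₂⟩ := exists_hasAddress fun m => a (m + 1 + 1)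
  obtain ⟨e₁', he₁'⟩ := exists_hasAddress fun m => a' (m + 1)
  obtain ⟨e₂', he₂'⟩ := exists_hasAddress fun m => a' (m + 1 + 1)
  rintro rfl
  have g1 := congrArg Prod.fst ((h.eq_phi he₁).symm.trans (h'.eq_phi he₁'))
  rw [he₁.eq_phi he₂, he₁'.eq_phi he₂'] at g1
  simp only [phi_eq, zero_add, h0, h1] at g1
  have b1 := (TFractal.mem_boundingBox.1 he₂.mem_boundingBox).1
  have b2 := (TFractal.mem_boundingBox.1 he₂'.mem_boundingBox).1
  rcases (a' 0).sign_eq with h | h <;> rw [h] at g1 <;> linarith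

/-! ### The renormalized dynamics -/

open Classical in
/-- The sign of a nonzero real number. -/
noncomputable def realSign (u : ℝ) : ℝ := if 0 < u then 1 else -1

theorem realSign_eq (u : ℝ) : realSign u = 1 ∨ realSign u = -1 := by
  unfold realSign
  split_ifs <;> simp

theorem realSign_mul_pos {u : ℝ} (hu : u ≠ 0) : 0 < realSign u * u := by
  unfold realSign
  split_ifs with h
  · linarith
  · have := lt_of_le_of_ne (not_lt.1 h) hu
    linarith

theorem realSign_neg {u : ℝ} (hu : u ≠ 0) : realSign (-u) = -realSign u := by
  have h1 := realSign_mul_pos hu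
  have h2 := realSign_mul_pos (neg_ne_zero.2 hu)
  rcases realSign_eq u with h | h <;> rcases realSign_eq (-u) with h' | h' <;>
    rw [h] at h1 ⊢ <;> rw [h'] at h2 ⊢ <;> linarith

/-- The positions, relative to the midpoint of the base and measured in the direction of motion,
at which a trajectory enters the successive copies: the orbit of `v - 1 / 2` under the doubling
map. -/
noncomputable def coord (v : ℝ) : ℕ → ℝ
  | 0 => v - 1 / 2
  | k + 1 => 2 * coord v k - realSign (coord v k) / 2

/-- The horizontal orientations with which a trajectory enters the successive copies. -/
noncomputable def orient (κ σ v : ℝ) : ℕ → ℝ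
  | 0 => σ
  | k + 1 => κ * orient κ σ v k * realSign (coord v k)

open Classical in
/-- The letters of the copies that are entered successively. -/
noncomputable def itinerary (κ σ v : ℝ) (k : ℕ) : Side :=
  if 0 < κ * orient κ σ v k then Side.R else Side.L

/-- The number is not a dyadic rational. -/
def NonDyadic (v : ℝ) : Prop := ∀ (k : ℕ) (m : ℤ), 2 ^ k * v ≠ m

section Dynamics

variable {κ σ v : ℝ}

theorem NonDyadic.one_sub (h : NonDyadic v) : NonDyadic (1 - v) := by
  intro k m hm
  refine h k (2 ^ k - m) ?_
  push_cast
  linarith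

/-- Each step subtracts an integer from twice the value of `coord + 1/2`; non-dyadicity and
rationality both enter through this formula. -/
theorem exists_coord_eq (v : ℝ) (k : ℕ) : ∃ m : ℤ, coord v k = 2 ^ k * v + m - 1 / 2 := by
  induction k with
  | zero => exact ⟨0, by simp [coord]⟩
  | succ k ih =>
    obtain ⟨m, hm⟩ := ih
    rw [coord]
    rcases realSign_eq (coord v k) with h | h <;> rw [h, hm]
    · exact ⟨2 * m - 1, by push_cast; ring⟩
    · exact ⟨2 * m, by push_cast; ring⟩

theorem coord_ne_zero (hv : NonDyadic v) (k : ℕ) : coord v k ≠ 0 := by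
  intro h
  obtain ⟨m, hm⟩ := exists_coord_eq v k
  refine hv (k + 1) (1 - 2 * m) ?_
  push_cast
  rw [pow_succ]
  linarith

theorem realSign_mul_coord_lt (hv : NonDyadic v) (h0 : 0 < v) (h1 : v < 1) (k : ℕ) :
    realSign (coord v k) * coord v k < 1 / 2 := by
  induction k with
  | zero =>
    rw [coord]
    rcases realSign_eq (v - 1 / 2) with h | h <;> rw [h] <;> linarith
  | succ k ih =>
    have hpos := realSign_mul_pos (coord_ne_zero hv k)
    have e : coord v (k + 1) = 2 * coord v k - realSign (coord v k) / 2 := rfl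
    rcases realSign_eq (coord v (k + 1)) with h | h <;> rw [h, e] <;>
      rcases realSign_eq (coord v k) with h' | h' <;> rw [h'] at ih hpos ⊢ <;> linarith

theorem abs_coord_lt (hv : NonDyadic v) (h0 : 0 < v) (h1 : v < 1) (k : ℕ) :
    |coord v k| < 1 / 2 := by
  have h2 := realSign_mul_coord_lt hv h0 h1 k
  have h3 := realSign_mul_pos (coord_ne_zero hv k)
  rw [abs_lt]
  rcases realSign_eq (coord v k) with h | h <;> rw [h] at h2 h3 <;> constructor <;> linarith

theorem orient_eq (hκ : κ = 1 ∨ κ = -1) (hσ : σ = 1 ∨ σ = -1) (v : ℝ) (k : ℕ) :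
    orient κ σ v k = 1 ∨ orient κ σ v k = -1 := by
  induction k with
  | zero => exact hσ
  | succ k ih =>
    rw [orient]
    rcases hκ with rfl | rfl <;> rcases ih with h | h <;>
      rcases realSign_eq (coord v k) with h' | h' <;> rw [h, h'] <;> norm_num

theorem sign_itinerary (hκ : κ = 1 ∨ κ = -1) (hσ : σ = 1 ∨ σ = -1) (v : ℝ) (k : ℕ) :
    (itinerary κ σ v k).sign = κ * orient κ σ v k := by
  unfold itinerary
  have ho := orient_eq hκ hσ v k
  rcases hκ with rfl | rfl <;> rcases ho with h | h <;> rw [h] <;>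
    norm_num [Side.sign]

/-- Signs square to 1, so consecutive orientations recover the sign of the coordinate between them.
-/
theorem realSign_coord_eq (hκ : κ = 1 ∨ κ = -1) (hσ : σ = 1 ∨ σ = -1) (v : ℝ) (k : ℕ) :
    realSign (coord v k) = κ * orient κ σ v k * orient κ σ v (k + 1) := by
  rw [orient]
  have ho := orient_eq hκ hσ v k
  rcases hκ with rfl | rfl <;> rcases ho with h | h <;> rw [h] <;> ring

/-- Expansiveness: as long as the signs agree, the doubling map doubles the difference, which stays
bounded only if it is 0. -/
theorem eq_of_realSign_coord_eq (hv : NonDyadic v) (h0 : 0 < v) (h1 : v < 1) {N M : ℕ}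
    (h : ∀ i, realSign (coord v (N + i)) = realSign (coord v (M + i))) :
    coord v N = coord v M := by
  have hd : ∀ i : ℕ, coord v (N + i) - coord v (M + i) = 2 ^ i * (coord v N - coord v M) := by
    intro i
    induction i with
    | zero => simp
    | succ i ih =>
      rw [← add_assoc, ← add_assoc, coord, coord, h i, pow_succ]
      linarith
  by_contra hne
  have hpos : 0 < |coord v N - coord v M| := abs_pos.2 (sub_ne_zero.2 hne)
  obtain ⟨i, hi⟩ := pow_unbounded_of_one_lt (1 / |coord v N - coord v M|) (one_lt_two (α := ℝ))
  rw [div_lt_iff₀ hpos] at hi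
  have h2 := congrArg abs (hd i)
  rw [abs_mul, abs_of_pos (by positivity : (0 : ℝ) < 2 ^ i)] at h2
  have h3 := abs_sub (coord v (N + i)) (coord v (M + i))
  linarith [abs_coord_lt hv h0 h1 (N + i), abs_coord_lt hv h0 h1 (M + i)]

/-- Preperiodic letters give preperiodic orientations, then signs, then a repeated coordinate, which
is a linear equation for v with integer coefficients. -/
theorem exists_rat_of_isPreperiodic_itinerary (hκ : κ = 1 ∨ κ = -1) (hσ : σ = 1 ∨ σ = -1)
    (hv : NonDyadic v) (h0 : 0 < v) (h1 : v < 1) (h : IsPreperiodic (itinerary κ σ v)) :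
    ∃ q : ℚ, v = q := by
  obtain ⟨N, q, hq, h⟩ := h
  have ho : ∀ n, N ≤ n → orient κ σ v (n + q) = orient κ σ v n := by
    intro n hn
    have := congrArg Side.sign (h n hn)
    rw [sign_itinerary hκ hσ, sign_itinerary hκ hσ] at this
    exact mul_left_cancel₀ (by rcases hκ with rfl | rfl <;> norm_num) this
  have heq : coord v (N + q) = coord v N := by
    refine eq_of_realSign_coord_eq hv h0 h1 fun i => ?_
    rw [realSign_coord_eq hκ hσ, realSign_coord_eq hκ hσ, add_right_comm, ho _ (by omega),
      add_right_comm, ho _ (by omega)]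
  obtain ⟨m, hm⟩ := exists_coord_eq v (N + q)
  obtain ⟨m', hm'⟩ := exists_coord_eq v N
  have hlt : (2 : ℝ) ^ N < 2 ^ (N + q) := pow_lt_pow_right₀ one_lt_two (by omega)
  refine ⟨(m' - m) / (2 ^ (N + q) - 2 ^ N), ?_⟩
  push_cast
  rw [eq_div_iff (sub_pos.2 hlt).ne']
  linarith

theorem isPreperiodic_itinerary_of_rat (hκ : κ = 1 ∨ κ = -1) (hσ : σ = 1 ∨ σ = -1)
    (hv : NonDyadic v) (h0 : 0 < v) (h1 : v < 1) (h : ∃ q : ℚ, v = q) :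
    IsPreperiodic (itinerary κ σ v) := by
  obtain ⟨q, hq⟩ := h
  have hd : (0 : ℝ) < q.den := by exact_mod_cast q.den_pos
  -- The denominator of v bounds that of every shifted coordinate, so the pairs of coordinate and
  -- orientation take finitely many values. A repeated pair makes the deterministic dynamics
  -- preperiodic.
  let t : Set (ℝ × ℝ) := ((fun m : ℤ => (m : ℝ) / q.den - 1 / 2) ''
    Icc 0 (q.den : ℤ)) ×ˢ {1, -1}
  have ht : t.Finite := ((finite_Icc _ _).image _).prod (toFinite _)
  obtain ⟨N, M, hNM, he⟩ := Set.Finite.exists_lt_map_eq_of_forall_mem (t := t)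
    (f := fun k => (coord v k, orient κ σ v k)) (fun k => by
      refine ⟨?_, orient_eq hκ hσ v k⟩
      obtain ⟨m, hm⟩ := exists_coord_eq v k
      have hvq : v * q.den = q.num := by
        rw [hq]
        exact_mod_cast Rat.mul_den_eq_num q
      have e : ((2 ^ k * q.num + m * q.den : ℤ) : ℝ) = (coord v k + 1 / 2) * q.den := by
        push_cast
        rw [hm, ← hvq]
        ring
      have hb := abs_lt.1 (abs_coord_lt hv h0 h1 k)
      refine ⟨2 ^ k * q.num + m * q.den, ⟨?_, ?_⟩, ?_⟩
      · have : (0 : ℝ) ≤ ((2 ^ k * q.num + m * q.den : ℤ) : ℝ) := by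
          rw [e]
          exact mul_nonneg (by linarith) hd.le
        exact_mod_cast this
      · have : ((2 ^ k * q.num + m * q.den : ℤ) : ℝ) ≤ ((q.den : ℤ) : ℝ) := by
          rw [e, Int.cast_natCast]
          exact mul_le_of_le_one_left hd.le (by linarith)
        exact_mod_cast this
      · dsimp only
        rw [e, mul_div_cancel_right₀ _ hd.ne']
        ring) ht
  obtain ⟨hc, hor⟩ := Prod.ext_iff.1 he
  dsimp only at hc hor
  have key : ∀ i, coord v (N + i) = coord v (M + i) ∧
      orient κ σ v (N + i) = orient κ σ v (M + i) := by
    intro i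
    induction i with
    | zero => exact ⟨hc, hor⟩
    | succ i ih =>
      rw [← add_assoc, ← add_assoc, coord, coord, orient, orient, ih.1, ih.2]
      exact ⟨rfl, rfl⟩
  refine ⟨N, M - N, by omega, fun n hn => ?_⟩
  have := (key (n - N)).2
  rw [show N + (n - N) = n by omega, show M + (n - N) = n + (M - N) by omega] at this
  unfold itinerary
  rw [this]

theorem coord_one_sub (hv : NonDyadic v) (k : ℕ) : coord (1 - v) k = -coord v k := by
  induction k with
  | zero => rw [coord, coord]; ring
  | succ k ih =>
    rw [coord, coord, ih, realSign_neg (coord_ne_zero hv k)]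
    ring

theorem isRational_iff_of_hasAddress_itinerary (hκ : κ = 1 ∨ κ = -1) (hσ : σ = 1 ∨ σ = -1)
    (hv : NonDyadic v) (h0 : 0 < v) (h1 : v < 1) {e : Plane}
    (he : HasAddress e (itinerary κ σ v)) : IsRationalElusivePoint e ↔ ∃ q : ℚ, v = q := by
  rw [he.isRational_iff]
  exact ⟨exists_rat_of_isPreperiodic_itinerary hκ hσ hv h0 h1,
    isPreperiodic_itinerary_of_rat hκ hσ hv h0 h1⟩

/-- Opposite directions lead to different elusive points. -/
theorem hasAddress_itinerary_ne (hκ : κ = 1 ∨ κ = -1) (hσ : σ = 1 ∨ σ = -1)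
    (hv : NonDyadic v) {e e' : Plane} (he : HasAddress e (itinerary κ σ v))
    (he' : HasAddress e' (itinerary κ (-σ) (1 - v))) : e ≠ e' := by
  have hσ' : -σ = 1 ∨ -σ = -1 := by rcases hσ with rfl | rfl <;> simp
  refine he.ne_of_zero_of_one he' ?_ ?_ <;> rw [sign_itinerary hκ hσ, sign_itinerary hκ hσ']
  · rw [orient, orient]
    ring
  · rw [orient, orient, orient, orient, coord_one_sub hv, realSign_neg (coord_ne_zero hv 0)]
    ring

/-- The billiard trajectory of slope `± 1 / p` that starts on the base follows the renormalized
dynamics. -/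
theorem exists_renormalizedOrbit {p j : ℕ} {C S e : ℝ} (hS : 0 < S) (hC : C = p * S)
    (he : e = 1 ∨ e = -1) (hpj : (p : ℝ) = 4 * j + e) (hσ : σ = 1 ∨ σ = -1) (hv : NonDyadic v)
    (h0 : 0 < v) (h1 : v < 1) :
    ∃ Q, RenormalizedOrbit
      (fun k => ((1 / 2 + orient (-(-1) ^ j * e) σ v k * coord v k, 0),
        (orient (-(-1) ^ j * e) σ v k * C, S)))
      (itinerary (-(-1) ^ j * e) σ v) Q := by
  have hκ : -(-1) ^ j * e = 1 ∨ -(-1) ^ j * e = -1 := by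
    rcases neg_one_pow_eq_or ℝ j with h | h <;> rcases he with rfl | rfl <;> rw [h] <;> norm_num
  have hA := fun k => exists_approach_phi (j := j) hS hC he hpj (orient_eq hκ hσ v k)
    (realSign_eq (coord v k)) (realSign_mul_pos (coord_ne_zero hv k))
    (realSign_mul_coord_lt hv h0 h1 k) (sign_itinerary hκ hσ v k)
  choose Q hQ using hA
  have hb : ∀ k, -(1 / 2) < orient (-(-1) ^ j * e) σ v k * coord v k ∧
      orient (-(-1) ^ j * e) σ v k * coord v k < 1 / 2 := by
    intro k
    have h := abs_lt.1 (abs_coord_lt hv h0 h1 k)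
    rcases orient_eq hκ hσ v k with h' | h' <;> rw [h'] <;> constructor <;> linarith
  exact ⟨Q, fun k => by linarith [(hb k).1], fun k => by linarith [(hb k).2], fun _ => rfl,
    fun _ => hS, hQ⟩

end Dynamics

end TFractal

/-! ### The main theorem -/

theorem mainTheorem7 (p : ℕ) (hp : Odd p) (x θ : ℝ) (hx : x ∈ Set.Icc (0 : ℝ) 1)
    (hdyadic : ∀ l m : ℕ, 0 < l → 0 < m → x ≠ (m : ℝ) / 2 ^ l)
    (hθ : θ ∈ Set.Ioo 0 Real.pi) (htan : Real.tan θ = 1 / (p : ℝ))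
    (X : ℕ → TFractal.Plane) (hX : X 0 = (x, 0))
    (hcompat : TFractal.IsCompatibleSequence X θ)
    (hper : ∀ n, TFractal.IsPeriodicOrbit (TFractal.preTable n) (X n, TFractal.direction θ)) :
    ∃ e₁ e₂ : TFractal.Plane, e₁ ≠ e₂ ∧
      TFractal.NontrivialPathConvergesTo X θ e₁ ∧
      TFractal.NontrivialPathConvergesTo X (Real.pi - θ) e₂ ∧
      (TFractal.IsRationalElusivePoint e₁ ↔ ∃ q : ℚ, x = (q : ℝ)) ∧
      (TFractal.IsRationalElusivePoint e₂ ↔ ∃ q : ℚ, x = (q : ℝ)) := by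
  open TFractal in
  have hS : 0 < Real.sin θ := Real.sin_pos_of_pos_of_lt_pi hθ.1 hθ.2
  have hp0 : (0 : ℝ) < p := by exact_mod_cast hp.pos
  have hC : Real.cos θ = p * Real.sin θ := by
    rw [Real.tan_eq_sin_div_cos] at htan
    have hne : Real.cos θ ≠ 0 := by
      intro h
      rw [h, div_zero] at htan
      exact (one_div_pos.2 hp0).ne htan
    rw [div_eq_div_iff hne hp0.ne'] at htan
    linarith
  -- The endpoint 0 has no representation with m > 0 and is excluded by periodicity; the endpoint 1
  -- is 2/2.
  have hx0 : 0 < x := by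
    refine lt_of_le_of_ne hx.1 fun h => ?_
    have := hper 0
    rw [hX, ← h, preTable_zero] at this
    exact not_isPeriodicOrbit_corner hp hS hC this
  have hx1 : x < 1 := lt_of_le_of_ne hx.2 fun h => hdyadic 1 2 one_pos two_pos (by rw [h]; norm_num)
  have hv : NonDyadic x := by
    intro k m hm
    have hm0 : 0 < m := by
      have : (0 : ℝ) < m := by rw [← hm]; positivity
      exact_mod_cast this
    lift m to ℕ using hm0.le
    refine hdyadic (k + 1) (2 * m) (Nat.succ_pos k) (by omega) ?_
    rw [eq_div_iff (by positivity), pow_succ]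
    push_cast at hm ⊢
    linarith
  have hXn := hcompat.eq_base hX hx.1 hx.2
  obtain ⟨j, e, he, hpj⟩ : ∃ (j : ℕ) (e : ℝ), (e = 1 ∨ e = -1) ∧ (p : ℝ) = 4 * j + e := by
    obtain ⟨k, rfl⟩ := hp
    rcases Nat.even_or_odd' k with ⟨i, rfl | rfl⟩
    · exact ⟨i, 1, Or.inl rfl, by push_cast; ring⟩
    · exact ⟨i + 1, -1, Or.inr rfl, by push_cast; ring⟩
  have hκ : -(-1) ^ j * e = 1 ∨ -(-1) ^ j * e = -1 := by
    rcases neg_one_pow_eq_or ℝ j with h | h <;> rcases he with rfl | rfl <;> rw [h] <;> norm_num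
  have hσ : (1 : ℝ) = 1 ∨ (1 : ℝ) = -1 := Or.inl rfl
  have hσ' : (-1 : ℝ) = 1 ∨ (-1 : ℝ) = -1 := Or.inr rfl
  obtain ⟨Q₁, hQ₁⟩ := exists_renormalizedOrbit hS hC he hpj hσ hv hx0 hx1
  -- Seen in the direction of motion, the reversed trajectory starts at 1 - x with orientation -1.
  obtain ⟨Q₂, hQ₂⟩ := exists_renormalizedOrbit hS hC he hpj hσ' hv.one_sub
    (sub_pos.2 hx1) (sub_lt_self 1 hx0)
  obtain ⟨e₁, he₁⟩ := exists_hasAddress (itinerary (-(-1) ^ j * e) 1 x)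
  obtain ⟨e₂, he₂⟩ := exists_hasAddress (itinerary (-(-1) ^ j * e) (-1) (1 - x))
  refine ⟨e₁, e₂, hasAddress_itinerary_ne hκ hσ hv he₁ he₂,
    hQ₁.converges (fun n => ?_) ?_ hcompat he₁, hQ₂.converges (fun n => ?_) ?_
      (isCompatibleSequence_base hXn hx0 hx1 (by rwa [Real.sin_pi_sub])) he₂,
    isRational_iff_of_hasAddress_itinerary hκ hσ hv hx0 hx1 he₁, ?_⟩
  · rw [hXn]
    ext
    · simp [orient, coord]
    · rfl
  · ext <;> simp [direction, orient]
  · rw [hXn]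
    ext
    · simp [orient, coord]
      ring
    · rfl
  · ext <;> simp [direction, orient]
  · rw [isRational_iff_of_hasAddress_itinerary hκ hσ' hv.one_sub (sub_pos.2 hx1)
      (sub_lt_self 1 hx0) he₂]
    constructor
    · rintro ⟨q, hq⟩
      exact ⟨1 - q, by push_cast; linarith⟩
    · rintro ⟨q, hq⟩
      exact ⟨1 - q, by push_cast; linarith⟩
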